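/- Let $A,B,C$ be quantum systems with finite-dimensional Hilbert spaces and let $\rho_{ABC}$ be a density operator (positive semi-definite, trace one), with marginals $\rho_{AC},\rho_{BC},\rho_C$. All logarithms are natural. Functions of Hermitian operators are evaluated on the support: for $X=\sum_{i:x_i\neq 0}x_i|i\rangle\langle i|$, $f(X)=\sum_{i:x_i\neq0}f(x_i)|i\rangle\langle i|$. Let $H(\sigma)=-\operatorname{Tr}\{\sigma\log\sigma\}$ and $$I(A;B|C)_\rho=H(\rho_{AC})+H(\rho_{BC})-H(\rho_C)-H(\rho_{ABC}).$$ For positive semi-definite $\rho,\sigma$ define, with values in $[-\infty,+\infty]$ for the last three and with $\log 0=-\infty$, $$F(\rho,\sigma)=\|\sqrt\rho\sqrt\sigma\|_1^2,\qquad D_0(\rho\|\sigma)=-\log\operatorname{Tr}\{\rho^0\sigma\},$$ $$D_2(\rho\|\sigma)=\log\operatorname{Tr}\{\rho^2\sigma^{-1}\},\qquad D_{\max}(\rho\|\sigma)=\log\|\sigma^{-1/2}\rho\,\sigma^{-1/2}\|_\infty ,$$ where $D_2$ and $D_{\max}$ are set to $+\infty$ unless $\operatorname{supp}\rho\subseteq\operatorname{supp}\sigma$.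 For a unitary $V$ on $AC$ commuting with $\rho_{AC}$ and a unitary $W$ on $C$ commuting with $\rho_C$, the swiveled Petz recovery map is $$\mathcal R^{V,W}_{C\to AC}(X)=V\rho_{AC}^{1/2}\left(I_A\otimes \rho_C^{-1/2}\,W X W^\dagger\,\rho_C^{-1/2}\right)\rho_{AC}^{1/2}V^\dagger ,$$ and $\mathcal R^{V,W}_{C\to AC}(\rho_{BC})$ denotes the operator on $ABC$ obtained by applying it to system $C$ of $\rho_{BC}$ (identity map on $B$). Below, maxima and minima are over all such pairs $(V,W)$; they are attained. Then $$-\log\Big[\max_{V,W}F\big(\rho_{ABC},\mathcal R^{V,W}_{C\to AC}(\rho_{BC})\big)\Big]\le I(A;B|C)_\rho,$$ $$\min_{V,W}D_0\big(\rho_{ABC}\big\|\mathcal R^{V,W}_{C\to AC}(\rho_{BC})\big)\le I(A;B|C)_\rho .$$ If moreover $\rho_{ABC}$ is positive definite, then $$I(A;B|C)_\rho\le\max_{V,W}D_{\max}\big(\rho_{ABC}\big\|\mathcal R^{V,W}_{C\to AC}(\rho_{BC})\big),$$ $$I(A;B|C)_\rho\le\max_{V,W}D_2\big(\rho_{ABC}\big\|\mathcal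 R^{V,W}_{C\to AC}(\rho_{BC})\big).$$ -/

import Mathlib

/-! Finite-dimensional quantum systems `A`, `B`, `C` are given by finite index types `a`, `b`, `c`
of orthonormal bases; operators are complex matrices, and an operator on `ABC` is a matrix indexed
by `a × b × c`. All logarithms are natural. -/

noncomputable section

namespace SwiveledRenyi

open scoped Kronecker Matrix ComplexOrder

variable {n a b c : Type*} [Fintype n] [DecidableEq n] [Fintype a] [DecidableEq a]
  [Fintype b] [DecidableEq b] [Fintype c] [DecidableEq c]

/-- A density operator: positive semi-definite with trace one. -/
def IsDensity (ρ : Matrix n n ℂ) : Prop := ρ.PosSemidef ∧ ρ.trace = 1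

/-- The function `f` of a Hermitian operator evaluated on its support: if
`A = ∑ aᵢ |i⟩⟨i|`, this is the sum of `f aᵢ |i⟩⟨i|` over the `i` with `aᵢ ≠ 0`. -/
def onSupport (f : ℝ → ℝ) (A : Matrix n n ℂ) : Matrix n n ℂ :=
  cfc (fun x : ℝ => if x = 0 then 0 else f x) A

/-- The power `A ^ r` of a positive semi-definite operator, taken on its support. -/
def suppPow (A : Matrix n n ℂ) (r : ℝ) : Matrix n n ℂ := onSupport (fun x => x ^ r) A

/-- The trace norm `‖X‖₁ = Tr √(X† X)`. -/
def traceNorm (X : Matrix n n ℂ) : ℝ := (suppPow (Xᴴ * X) (1 / 2)).trace.re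

/-- The quantum fidelity `F(ρ, σ) = ‖√ρ √σ‖₁²`. -/
def fidelity (ρ σ : Matrix n n ℂ) : ℝ :=
  traceNorm (suppPow ρ (1 / 2) * suppPow σ (1 / 2)) ^ 2

/-- The logarithm of a non-negative real number, with `log 0 = -∞`. -/
def elog (x : ℝ) : EReal := ENNReal.log (ENNReal.ofReal x)

/-- `supp ρ ⊆ supp σ`; the support of a Hermitian operator, the span of its eigenvectors with
non-zero eigenvalue, is its range. -/
def SuppLE (ρ σ : Matrix n n ℂ) : Prop :=
  LinearMap.range ρ.mulVecLin ≤ LinearMap.range σ.mulVecLin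

open Classical in
/-- The Rényi relative entropy `D_α(ρ‖σ) = (α - 1)⁻¹ log Tr {ρ ^ α σ ^ (1 - α)}` for
`α ∈ [0, 1) ∪ (1, ∞)`; it is `+∞` if `α > 1` and `supp ρ ⊄ supp σ`. For `α = 0` it reads
`- log Tr {ρ ^ 0 σ}`, with `ρ ^ 0` the projection onto the support of `ρ`, and for `α = 2` it reads
`log Tr {ρ ^ 2 σ ^ (-1)}`. -/
def renyiRelEntropy (α : ℝ) (ρ σ : Matrix n n ℂ) : EReal :=
  if 1 < α ∧ ¬ SuppLE ρ σ then ⊤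
  else (((α - 1)⁻¹ : ℝ) : EReal) * elog (suppPow ρ α * suppPow σ (1 - α)).trace.re

open Classical in
/-- The max-relative entropy `D_max(ρ‖σ) = log ‖σ ^ (-1/2) ρ σ ^ (-1/2)‖`, with the operator norm
with respect to the Euclidean norm; it is `+∞` if `supp ρ ⊄ supp σ`. -/
def maxRelEntropy (ρ σ : Matrix n n ℂ) : EReal :=
  if SuppLE ρ σ then
    elog ‖Matrix.toEuclideanCLM (𝕜 := ℂ) (suppPow σ (-1 / 2) * ρ * suppPow σ (-1 / 2))‖
  else ⊤

/-- The von Neumann entropy `H(σ) = - Tr {σ log σ}`. -/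
def entropy (σ : Matrix n n ℂ) : ℝ := - (σ * onSupport Real.log σ).trace.re

/-- The marginal `ρ_AC = Tr_B ρ_ABC`. -/
def margAC (ρ : Matrix (a × b × c) (a × b × c) ℂ) : Matrix (a × c) (a × c) ℂ :=
  Matrix.of fun p q => ∑ j, ρ (p.1, j, p.2) (q.1, j, q.2)

/-- The marginal `ρ_BC = Tr_A ρ_ABC`. -/
def margBC (ρ : Matrix (a × b × c) (a × b × c) ℂ) : Matrix (b × c) (b × c) ℂ :=
  Matrix.of fun p q => ∑ i, ρ (i, p) (i, q)

/-- The marginal `ρ_C = Tr_AB ρ_ABC`. -/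
def margC (ρ : Matrix (a × b × c) (a × b × c) ℂ) : Matrix c c ℂ :=
  Matrix.of fun k l => ∑ i, ∑ j, ρ (i, j, k) (i, j, l)

/-- The conditional mutual information
`I(A;B|C) = H(AC) + H(BC) - H(C) - H(ABC)`. -/
def condMutualInfo (ρ : Matrix (a × b × c) (a × b × c) ℂ) : ℝ :=
  entropy (margAC ρ) + entropy (margBC ρ) - entropy (margC ρ) - entropy ρ

/-- The set of all unitaries commuting with `ω`. -/
def swivels (ω : Matrix n n ℂ) : Set (Matrix n n ℂ) :=
  {V | V ∈ Matrix.unitaryGroup n ℂ ∧ Commute V ω}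

/-- The map `X ↦ V X V†`. -/
def conjBy (V X : Matrix n n ℂ) : Matrix n n ℂ := V * X * Vᴴ

/-- The Petz recovery map of `ρ_AC` and `Tr_A`, from operators on `C` to operators on `AC`:
`X ↦ ρ_AC ^ (1/2) (I_A ⊗ ρ_C ^ (-1/2) X ρ_C ^ (-1/2)) ρ_AC ^ (1/2)`. -/
def petzMap (ρ : Matrix (a × b × c) (a × b × c) ℂ) (X : Matrix c c ℂ) :
    Matrix (a × c) (a × c) ℂ :=
  suppPow (margAC ρ) (1 / 2) *
    ((1 : Matrix a a ℂ) ⊗ₖ (suppPow (margC ρ) (-1 / 2) * X * suppPow (margC ρ) (-1 / 2))) *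
    suppPow (margAC ρ) (1 / 2)

/-- The swiveled Petz recovery map from `C` to `AC`: first conjugation by `W`, then the Petz map,
then conjugation by `V`. -/
def swiveledPetzMap (ρ : Matrix (a × b × c) (a × b × c) ℂ) (V : Matrix (a × c) (a × c) ℂ)
    (W : Matrix c c ℂ) (X : Matrix c c ℂ) : Matrix (a × c) (a × c) ℂ :=
  conjBy V (petzMap ρ (conjBy W X))

/-- The action on `BC` of a map `Φ` from `C` to `AC`, with the identity on `B`: on the operator
`∑ |j⟩⟨j'| ⊗ X_{jj'}` it is `∑ |j⟩⟨j'| ⊗ Φ(X_{jj'})`, with the output systems in the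
order `A`, `B`, `C`. -/
def applyToC (Φ : Matrix c c ℂ → Matrix (a × c) (a × c) ℂ) (X : Matrix (b × c) (b × c) ℂ) :
    Matrix (a × b × c) (a × b × c) ℂ :=
  Matrix.of fun p q =>
    Φ (Matrix.of fun k l => X (p.2.1, k) (q.2.1, l)) (p.1, p.2.2) (q.1, q.2.2)

/-- The recovered operator `R^{V,W}_{C → AC}(ρ_BC)` on `ABC`. -/
def recovered (ρ : Matrix (a × b × c) (a × b × c) ℂ) (V : Matrix (a × c) (a × c) ℂ)
    (W : Matrix c c ℂ) : Matrix (a × b × c) (a × b × c) ℂ :=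
  applyToC (swiveledPetzMap ρ V W) (margBC ρ)

/-- The set of values of a function `f` of the swivels `V ∈ 𝕍_{ρ_AC}` and `W ∈ 𝕍_{ρ_C}`,
evaluated at the recovered operator. -/
def recoveryValues {T : Type*} (ρ : Matrix (a × b × c) (a × b × c) ℂ)
    (f : Matrix (a × b × c) (a × b × c) ℂ → T) : Set T :=
  {t | ∃ V ∈ swivels (margAC ρ), ∃ W ∈ swivels (margC ρ), t = f (recovered ρ V W)}

end SwiveledRenyi

end

open SwiveledRenyi
open scoped ComplexOrder

set_option linter.unusedSectionVars false
set_option linter.unusedDecidableInType false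

namespace SwiveledRenyi

open scoped Kronecker Matrix ComplexOrder MatrixOrder Matrix.Norms.L2Operator

variable {n m a b c : Type*} [Fintype n] [DecidableEq n] [Fintype m] [DecidableEq m]
  [Fintype a] [DecidableEq a] [Fintype b] [DecidableEq b] [Fintype c] [DecidableEq c]

/-! ### Functional calculus on the support -/

/-! The proof is Hadamard's three lines theorem, differentiated at the edge of the strip. Write `A`,
`B`, `C` for `ρ_AC`, `ρ_BC`, `ρ_C` embedded in `ABC`, with powers on the support, and put `h(z) = Tr
{√ρ A^(z/2) C^(-z/2) B^(z/2) ρ^(-z/2) √ρ}`. Then `h(0) = 1`, and `|h| ≤ 1` on `Re z = 0`, where only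
unitaries and projections occur. For `z = 1 + 2it` the value is `Tr {√ρ K D}` with a contraction `D`
and `K Kᴴ` the state recovered with `V = ρ_AC^(it)`, `W = ρ_C^(-it)`; by polar decomposition `|h|²`
is at most the fidelity of `ρ` with that state, hence at most any bound `M` for these fidelities. So
`Re h(θ) ≤ M^(θ/2)` on `[0, 1]`, with equality at `0`. Comparing derivatives at `0` gives
`-I(A;B|C)/2 = Re h'(0) ≤ (log M)/2`, the fidelity bound (`re_deriv_le_log_of_strip`,
`re_trace_le_log_of_strip`, `logTrace_le_log_of_fidelity_le`). The `D_0` bound follows from `F(ρ, σ)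
≤ Tr {ρ^0 σ}`.

For the upper bounds the product is inverted: `B^(-z/2) C^(z/2) A^(-z/2) ρ^(z/2)`. On `Re z = 1` it
contains `K⁻¹`, and Cauchy–Schwarz bounds `|h|²` by `Tr {ρ² (K Kᴴ)⁻¹}`, which is the `D_2` bound
(`neg_logTrace_le_log_of_trace_le`); `D_2 ≤ D_max` gives the last one. Extrema are attained because
the swivels form a compact set. -/

theorem continuousOn_real_spectrum (f : ℝ → ℝ) (A : Matrix n n ℂ) :
    ContinuousOn f (spectrum ℝ A) :=
  Matrix.finite_real_spectrum.continuousOn f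

theorem onSupport_isHermitian (f : ℝ → ℝ) (A : Matrix n n ℂ) : (onSupport f A).IsHermitian :=
  cfc_predicate (p := IsSelfAdjoint) _ A

theorem suppPow_isHermitian (A : Matrix n n ℂ) (r : ℝ) : (suppPow A r).IsHermitian :=
  onSupport_isHermitian _ A

theorem spectrum_nonneg {A : Matrix n n ℂ} (hA : A.PosSemidef) {x : ℝ} (hx : x ∈ spectrum ℝ A) :
    0 ≤ x := by
  simpa using spectrum_nonneg_of_nonneg (Matrix.nonneg_iff_posSemidef.2 hA) hx

theorem suppPow_mul {A : Matrix n n ℂ} (hA : A.PosSemidef) (r s : ℝ) :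
    suppPow A r * suppPow A s = suppPow A (r + s) := by
  unfold suppPow onSupport
  rw [← cfc_mul _ _ A (continuousOn_real_spectrum _ A) (continuousOn_real_spectrum _ A)]
  refine cfc_congr fun x hx => ?_
  rcases (spectrum_nonneg hA hx).eq_or_lt with h | h
  · simp [← h]
  · simp [h.ne', Real.rpow_add h]

theorem suppPow_one {A : Matrix n n ℂ} (hA : A.IsHermitian) : suppPow A 1 = A := by
  unfold suppPow onSupport
  conv_rhs => rw [← cfc_id ℝ A hA]
  refine cfc_congr fun x _ => ?_
  by_cases h : x = 0 <;> simp [h]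

theorem suppPow_posSemidef {A : Matrix n n ℂ} (hA : A.PosSemidef) (r : ℝ) :
    (suppPow A r).PosSemidef := by
  rw [← Matrix.nonneg_iff_posSemidef]
  refine cfc_nonneg fun x hx => ?_
  have := Real.rpow_nonneg (spectrum_nonneg hA hx) r
  split_ifs <;> simp [this]

theorem suppPow_half_mul_self {A : Matrix n n ℂ} (hA : A.PosSemidef) :
    suppPow A (1 / 2) * suppPow A (1 / 2) = A := by
  rw [suppPow_mul hA, add_halves, suppPow_one hA.isHermitian]

theorem suppPow_zero_mul {A : Matrix n n ℂ} (hA : A.PosSemidef) (r : ℝ) :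
    suppPow A 0 * suppPow A r = suppPow A r := by
  rw [suppPow_mul hA, zero_add]

theorem suppPow_half_eq_sqrt {A : Matrix n n ℂ} (hA : A.PosSemidef) :
    suppPow A (1 / 2) = CFC.sqrt A :=
  (CFC.sqrt_unique (suppPow_half_mul_self hA)
    (Matrix.nonneg_iff_posSemidef.2 (suppPow_posSemidef hA _))).symm

theorem suppPow_zero_mul_self {A : Matrix n n ℂ} (hA : A.PosSemidef) : suppPow A 0 * A = A := by
  have h := suppPow_zero_mul hA 1
  rwa [suppPow_one hA.isHermitian] at h

theorem suppPow_zero_of_posDef {A : Matrix n n ℂ} (hA : A.PosDef) : suppPow A 0 = 1 := by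
  have h := suppPow_zero_mul_self hA.posSemidef
  exact hA.isUnit.mul_right_cancel (by rw [h, one_mul])

theorem suppPow_neg_one_of_posDef {A : Matrix n n ℂ} (hA : A.PosDef) : suppPow A (-1) = A⁻¹ := by
  refine (Matrix.inv_eq_left_inv ?_).symm
  have h := suppPow_mul hA.posSemidef (-1) 1
  rwa [suppPow_one hA.isHermitian, neg_add_cancel, suppPow_zero_of_posDef hA] at h

/-- The exponential of a multiple of the logarithm on the support is the power on the support. -/
theorem exp_smul_log_mul_suppPow_zero {A : Matrix n n ℂ} (hA : A.PosSemidef) (r : ℝ) :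
    NormedSpace.exp ((r : ℂ) • onSupport Real.log A) * suppPow A 0 = suppPow A r := by
  have h1 : (r : ℂ) • onSupport Real.log A =
      cfc (fun x : ℝ => r * (if x = 0 then 0 else Real.log x)) A := by
    rw [cfc_const_mul _ _ A (continuousOn_real_spectrum _ A)]
    ext i j
    simp [onSupport]
  have h2 := cfc_comp' Real.exp (fun x : ℝ => r * (if x = 0 then 0 else Real.log x)) A
    Real.continuous_exp.continuousOn (continuousOn_real_spectrum _ A) hA.isHermitian
  have h3 := CFC.real_exp_eq_normedSpace_exp (cfc_predicate (p := IsSelfAdjoint)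
    (fun x : ℝ => r * (if x = 0 then 0 else Real.log x)) A)
  rw [h1, ← h3]
  refine (congrArg (· * suppPow A 0) h2.symm).trans ?_
  unfold suppPow onSupport
  rw [← cfc_mul _ _ A (continuousOn_real_spectrum _ A) (continuousOn_real_spectrum _ A)]
  refine cfc_congr fun x hx => ?_
  rcases (spectrum_nonneg hA hx).eq_or_lt with h | h
  · simp [← h]
  · simp [h.ne', Real.rpow_def_of_pos h, mul_comm]

theorem onSupport_commute (f g : ℝ → ℝ) (A : Matrix n n ℂ) :
    Commute (onSupport f A) (onSupport g A) :=
  cfc_commute_cfc _ _ A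

theorem onSupport_commute_self (f : ℝ → ℝ) {A : Matrix n n ℂ} (hA : A.IsHermitian) :
    Commute (onSupport f A) A := by
  have h := onSupport_commute f (fun x => x ^ (1 : ℝ)) A
  rwa [show onSupport (fun x => x ^ (1 : ℝ)) A = A from suppPow_one hA] at h

/-- Functional calculus commutes with star homomorphisms, so powers and logarithms of a marginal may
be taken before or after embedding it in `ABC`. -/
theorem map_onSupport (φ : Matrix n n ℂ →⋆ₐ[ℂ] Matrix m m ℂ) (f : ℝ → ℝ) {A : Matrix n n ℂ}
    (hA : A.IsHermitian) : φ (onSupport f A) = onSupport f (φ A) :=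
  StarAlgHomClass.map_cfc (S := ℂ) φ _ A (continuousOn_real_spectrum _ A)
    φ.toAlgHom.toLinearMap.continuous_of_finiteDimensional hA (hA.isSelfAdjoint.map φ)

theorem map_suppPow (φ : Matrix n n ℂ →⋆ₐ[ℂ] Matrix m m ℂ) (r : ℝ) {A : Matrix n n ℂ}
    (hA : A.IsHermitian) : φ (suppPow A r) = suppPow (φ A) r :=
  map_onSupport φ _ hA

/-! ### Unitaries and contractions -/

theorem norm_le_one_of_conjTranspose_mul_self {U : Matrix n n ℂ} (h : Uᴴ * U = 1) : ‖U‖ ≤ 1 := by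
  have h1 := Matrix.l2_opNorm_conjTranspose_mul_self U
  rw [h] at h1
  rcases isEmpty_or_nonempty n with _ | _
  · rw [Subsingleton.elim U 0, norm_zero]; exact zero_le_one
  · rw [CStarRing.norm_one] at h1
    nlinarith [norm_nonneg U]

/-- For a projection `P`, the C*-identity reads `‖P‖ = ‖P‖²`. -/
theorem norm_suppPow_zero_le {A : Matrix n n ℂ} (hA : A.PosSemidef) : ‖suppPow A 0‖ ≤ 1 := by
  have h1 := Matrix.l2_opNorm_conjTranspose_mul_self (suppPow A 0)
  rw [(suppPow_isHermitian A 0).eq, suppPow_zero_mul hA] at h1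
  by_contra! h
  nlinarith

theorem exp_I_smul_mem_unitaryGroup {X : Matrix n n ℂ} (hX : X.IsHermitian) {z : ℂ}
    (hz : z.re = 0) : NormedSpace.exp (z • X) ∈ Matrix.unitaryGroup n ℂ := by
  have hs : (z • X)ᴴ = -(z • X) := by
    rw [Matrix.conjTranspose_smul, hX.eq, ← neg_smul]
    congr 1
    apply Complex.ext <;> simp [hz]
  rw [Matrix.mem_unitaryGroup_iff, Matrix.star_eq_conjTranspose, ← Matrix.exp_conjTranspose, hs,
    ← Matrix.exp_add_of_commute _ _ ((Commute.refl (z • X)).neg_right), add_neg_cancel,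
    NormedSpace.exp_zero]

theorem norm_le_one_of_mem_unitaryGroup {U : Matrix n n ℂ} (h : U ∈ Matrix.unitaryGroup n ℂ) :
    ‖U‖ ≤ 1 :=
  norm_le_one_of_conjTranspose_mul_self (Matrix.mem_unitaryGroup_iff'.1 h)

/-! ### Trace inequalities -/

theorem trace_conjTranspose_mul_self_re_nonneg (X : Matrix m n ℂ) : 0 ≤ (Xᴴ * X).trace.re :=
  (Complex.nonneg_iff.1 (Matrix.posSemidef_conjTranspose_mul_self X).trace_nonneg).1

/-- The Cauchy–Schwarz inequality for the Hilbert–Schmidt inner product. -/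
theorem norm_trace_mul_le (X Y : Matrix n n ℂ) :
    ‖(X * Y).trace‖ ≤ √((X * Xᴴ).trace.re) * √((Yᴴ * Y).trace.re) := by
  -- One matrix is conjugated and the other transposed, so that the Euclidean inner product of the
  -- flattened matrices is `Tr {X Y}`.
  let x : EuclideanSpace ℂ (n × n) := WithLp.toLp 2 fun p => star (X p.1 p.2)
  let y : EuclideanSpace ℂ (n × n) := WithLp.toLp 2 fun p => Y p.2 p.1
  have h := norm_inner_le_norm (𝕜 := ℂ) x y
  have h1 : inner ℂ x y = (X * Y).trace := by
    simp [x, y, PiLp.inner_apply, Matrix.trace, Matrix.mul_apply, Fintype.sum_prod_type, mul_comm]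
  have h2 : ‖x‖ = √((X * Xᴴ).trace.re) := by
    rw [EuclideanSpace.norm_eq]
    simp [x, Matrix.trace, Matrix.mul_apply, Fintype.sum_prod_type, Complex.mul_conj,
      Complex.normSq_eq_norm_sq]
    simp only [← Complex.ofReal_pow, Complex.ofReal_re]
  have h3 : ‖y‖ = √((Yᴴ * Y).trace.re) := by
    rw [EuclideanSpace.norm_eq, Fintype.sum_prod_type]
    simp only [y, Matrix.trace, Matrix.mul_apply, Matrix.diag, Complex.re_sum,
      Matrix.conjTranspose_apply]
    congr 1
    refine Finset.sum_congr rfl fun i _ => Finset.sum_congr rfl fun j _ => ?_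
    simp [← Complex.normSq_eq_norm_sq, Complex.normSq_apply]
  rwa [h1, h2, h3] at h

theorem trace_conjTranspose_mul_self_mul_le (C X : Matrix n n ℂ) :
    ((C * X)ᴴ * (C * X)).trace.re ≤ ‖C‖ ^ 2 * (Xᴴ * X).trace.re := by
  have h1 : Cᴴ * C ≤ algebraMap ℝ (Matrix n n ℂ) (‖C‖ ^ 2) := by
    have := IsSelfAdjoint.le_algebraMap_norm_self (a := Cᴴ * C)
      (Matrix.isHermitian_conjTranspose_mul_self C)
    rwa [Matrix.l2_opNorm_conjTranspose_mul_self, ← sq] at this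
  have h2 := ((Matrix.le_iff.1 h1).conjTranspose_mul_mul_same X).trace_nonneg
  have h3 := (Complex.nonneg_iff.1 h2).1
  have h4 : Xᴴ * (algebraMap ℝ (Matrix n n ℂ) (‖C‖ ^ 2) - Cᴴ * C) * X =
      (‖C‖ ^ 2 : ℝ) • (Xᴴ * X) - (C * X)ᴴ * (C * X) := by
    rw [Algebra.algebraMap_eq_smul_one, Matrix.mul_sub, Matrix.sub_mul, Matrix.conjTranspose_mul]
    simp [Matrix.mul_assoc]
  rw [h4, Matrix.trace_sub, Matrix.trace_smul, Complex.sub_re, Complex.smul_re, smul_eq_mul] at h3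
  linarith

/-- `|Tr {C Xᴴ X}| ≤ ‖C‖ Tr {Xᴴ X}`. -/
theorem norm_trace_mul_conjTranspose_mul_self_le (C X : Matrix n n ℂ) :
    ‖(C * (Xᴴ * X)).trace‖ ≤ ‖C‖ * (Xᴴ * X).trace.re := by
  have h1 : (C * (Xᴴ * X)).trace = (X * (C * Xᴴ)).trace := by
    rw [← Matrix.mul_assoc, Matrix.trace_mul_comm]
  rw [h1]
  refine (norm_trace_mul_le _ _).trans ?_
  have h2 := trace_conjTranspose_mul_self_mul_le C Xᴴ
  rw [Matrix.conjTranspose_conjTranspose, Matrix.trace_mul_comm X] at h2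
  rw [Matrix.trace_mul_comm X]
  have h3 := trace_conjTranspose_mul_self_re_nonneg X
  calc _ ≤ √((Xᴴ * X).trace.re) * √(‖C‖ ^ 2 * (Xᴴ * X).trace.re) := by gcongr
    _ = ‖C‖ * (√((Xᴴ * X).trace.re) * √((Xᴴ * X).trace.re)) := by
      rw [Real.sqrt_mul (by positivity), Real.sqrt_sq (norm_nonneg C)]; ring
    _ = _ := by rw [Real.mul_self_sqrt h3]

theorem norm_trace_mul_le_of_posSemidef (C : Matrix n n ℂ) {A : Matrix n n ℂ}
    (hA : A.PosSemidef) : ‖(C * A).trace‖ ≤ ‖C‖ * A.trace.re := by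
  have h := norm_trace_mul_conjTranspose_mul_self_le C (suppPow A (1 / 2))
  rwa [(suppPow_isHermitian A _).eq, suppPow_half_mul_self hA] at h

/-! ### Supports and the polar decomposition -/

/-- The support projection of a positive semi-definite operator fixes every operator whose range
lies in the support. -/
theorem suppPow_zero_mul_of_trace_eq {A σ : Matrix n n ℂ} (hA : A.PosSemidef)
    {X : Matrix n n ℂ} (hX : X * Xᴴ = σ)
    (h : ((1 - suppPow A 0) * σ).trace = 0) : suppPow A 0 * X = X := by
  set Q := 1 - suppPow A 0 with hQ
  have hQh : Qᴴ = Q := by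
    rw [hQ, Matrix.conjTranspose_sub, Matrix.conjTranspose_one, (suppPow_isHermitian A 0).eq]
  have hQQ : Q * Q = Q := by
    rw [hQ, mul_sub, sub_mul, sub_mul, suppPow_zero_mul hA]; simp
  -- The squared Hilbert–Schmidt norm of `Q X` is `Tr {Q σ}`, which vanishes.
  have h1 : ((Q * X)ᴴ * (Q * X)).trace = 0 := by
    rw [Matrix.trace_mul_comm, Matrix.conjTranspose_mul, hQh]
    rw [show Q * X * (Xᴴ * Q) = Q * σ * Q by rw [← hX]; simp only [Matrix.mul_assoc],
      Matrix.trace_mul_comm, ← Matrix.mul_assoc, hQQ, h]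
  have h2 := Matrix.trace_conjTranspose_mul_self_eq_zero_iff.1 h1
  rw [hQ, sub_mul, one_mul, sub_eq_zero] at h2
  exact h2.symm

/-- Polar decomposition: `K = √(K Kᴴ) U` and `√(K Kᴴ) = K Uᴴ` for a contraction `U`. -/
theorem exists_polar (K : Matrix n n ℂ) : ∃ U : Matrix n n ℂ, ‖U‖ ≤ 1 ∧
    K = suppPow (K * Kᴴ) (1 / 2) * U ∧ suppPow (K * Kᴴ) (1 / 2) = K * Uᴴ := by
  have hR := Matrix.posSemidef_self_mul_conjTranspose K
  set R := K * Kᴴ with hRdef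
  have hK : suppPow R 0 * K = K :=
    suppPow_zero_mul_of_trace_eq hR hRdef.symm
      (by rw [sub_mul, one_mul, suppPow_zero_mul_self hR, sub_self, Matrix.trace_zero])
  have h1 : suppPow R (-1 / 2) * R = suppPow R (1 / 2) := by
    nth_rewrite 2 [← suppPow_one hR.isHermitian]
    rw [suppPow_mul hR]; norm_num
  have h2 : R * suppPow R (-1 / 2) = suppPow R (1 / 2) := by
    nth_rewrite 1 [← suppPow_one hR.isHermitian]
    rw [suppPow_mul hR]; norm_num
  -- With `U = R^(-1/2) K` one has `U Uᴴ = R^0`, a projection, whence the norm bound.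
  refine ⟨suppPow R (-1 / 2) * K, ?_, ?_, ?_⟩
  · have h3 := Matrix.l2_opNorm_conjTranspose_mul_self (suppPow R (-1 / 2) * K)ᴴ
    rw [Matrix.l2_opNorm_conjTranspose, Matrix.conjTranspose_conjTranspose, Matrix.conjTranspose_mul,
      (suppPow_isHermitian R _).eq, Matrix.mul_assoc, ← Matrix.mul_assoc K, ← hRdef, h2,
      suppPow_mul hR, show (-1 / 2 + 1 / 2 : ℝ) = 0 by norm_num] at h3
    have h4 := norm_suppPow_zero_le hR
    by_contra! h
    nlinarith
  · rw [← Matrix.mul_assoc, suppPow_mul hR]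
    norm_num
    exact hK.symm
  · rw [Matrix.conjTranspose_mul, (suppPow_isHermitian R _).eq, ← Matrix.mul_assoc, ← hRdef, h2]

/-- Polar decomposition of `Xᴴ` gives `X = Uᴴ √(Xᴴ X)`, and the contraction is absorbed into `C`.
Together with `exists_traceNorm_eq` this is the variational formula for the trace norm. -/
theorem norm_trace_mul_le_traceNorm (C X : Matrix n n ℂ) :
    ‖(C * X).trace‖ ≤ ‖C‖ * traceNorm X := by
  obtain ⟨U, hU, hX, -⟩ := exists_polar Xᴴ
  rw [Matrix.conjTranspose_conjTranspose] at hX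
  have hp := suppPow_posSemidef (Matrix.posSemidef_conjTranspose_mul_self X) (1 / 2)
  have h1 : C * X = C * Uᴴ * suppPow (Xᴴ * X) (1 / 2) := by
    conv_lhs => rw [← Matrix.conjTranspose_conjTranspose X, hX]
    rw [Matrix.conjTranspose_mul, hp.isHermitian.eq, Matrix.mul_assoc]
  rw [h1]
  refine (norm_trace_mul_le_of_posSemidef _ hp).trans ?_
  rw [traceNorm]
  gcongr
  · exact (Complex.nonneg_iff.1 hp.trace_nonneg).1
  · calc _ ≤ ‖C‖ * ‖Uᴴ‖ := norm_mul_le _ _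
      _ ≤ ‖C‖ * 1 := by rw [Matrix.l2_opNorm_conjTranspose]; gcongr
      _ = _ := mul_one _

theorem exists_traceNorm_eq (X : Matrix n n ℂ) :
    ∃ U : Matrix n n ℂ, ‖U‖ ≤ 1 ∧ traceNorm X = ‖(U * X).trace‖ := by
  obtain ⟨U, hU, -, hX⟩ := exists_polar Xᴴ
  rw [Matrix.conjTranspose_conjTranspose] at hX
  have hp := suppPow_posSemidef (Matrix.posSemidef_conjTranspose_mul_self X) (1 / 2)
  refine ⟨U, hU, ?_⟩
  have h1 : U * X = suppPow (Xᴴ * X) (1 / 2) := by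
    rw [← hp.isHermitian.eq, hX, Matrix.conjTranspose_mul]; simp
  rw [traceNorm, h1]
  exact (congrArg Complex.re (Complex.norm_of_nonneg' hp.trace_nonneg)).symm.trans
    (Complex.ofReal_re _)

theorem traceNorm_nonneg (X : Matrix n n ℂ) : 0 ≤ traceNorm X := by
  obtain ⟨U, -, h⟩ := exists_traceNorm_eq X
  rw [h]
  exact norm_nonneg _

/-- `|Tr {√ρ K D}|² ≤ F(ρ, K Kᴴ)` for a contraction `D`. -/
theorem norm_trace_sq_le_fidelity (ρ K D : Matrix n n ℂ) (hD : ‖D‖ ≤ 1) :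
    ‖(suppPow ρ (1 / 2) * K * D).trace‖ ^ 2 ≤ fidelity ρ (K * Kᴴ) := by
  obtain ⟨U, hU, hK, -⟩ := exists_polar K
  have h1 : (suppPow ρ (1 / 2) * K * D).trace =
      (U * D * (suppPow ρ (1 / 2) * suppPow (K * Kᴴ) (1 / 2))).trace := by
    nth_rewrite 1 [hK]
    rw [Matrix.trace_mul_comm (U * D)]
    simp only [Matrix.mul_assoc]
  rw [fidelity, h1]
  gcongr
  refine (norm_trace_mul_le_traceNorm _ _).trans ?_
  have h2 : ‖U * D‖ ≤ 1 := (norm_mul_le _ _).trans (mul_le_one₀ hU (norm_nonneg _) hD)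
  nlinarith [traceNorm_nonneg (suppPow ρ (1 / 2) * suppPow (K * Kᴴ) (1 / 2))]

/-- Write the trace norm as `|Tr {(U √ρ)(ρ^0 √σ)}|` and apply Cauchy–Schwarz: the first factor
contributes at most `Tr ρ = 1`, the second `Tr {ρ^0 σ}`. -/
theorem fidelity_le_trace {ρ σ : Matrix n n ℂ} (hρ : IsDensity ρ) (hσ : σ.PosSemidef) :
    fidelity ρ σ ≤ (suppPow ρ 0 * σ).trace.re := by
  obtain ⟨U, hU, h⟩ := exists_traceNorm_eq (suppPow ρ (1 / 2) * suppPow σ (1 / 2))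
  have hs := suppPow_half_mul_self hρ.1
  have h1 : U * (suppPow ρ (1 / 2) * suppPow σ (1 / 2)) =
      U * suppPow ρ (1 / 2) * (suppPow ρ 0 * suppPow σ (1 / 2)) := by
    rw [← Matrix.mul_assoc (U * _), Matrix.mul_assoc U _ (suppPow ρ 0), suppPow_mul hρ.1,
      add_zero, Matrix.mul_assoc]
  have h2 := norm_trace_mul_le (U * suppPow ρ (1 / 2)) (suppPow ρ 0 * suppPow σ (1 / 2))
  have h3 : (U * suppPow ρ (1 / 2) * (U * suppPow ρ (1 / 2))ᴴ).trace.re ≤ 1 := by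
    have := trace_conjTranspose_mul_self_mul_le U (suppPow ρ (1 / 2))
    rw [(suppPow_isHermitian ρ _).eq, hs, hρ.2, Complex.one_re, mul_one] at this
    rw [Matrix.trace_mul_comm]
    exact this.trans (pow_le_one₀ (norm_nonneg _) hU)
  have h4 : ((suppPow ρ 0 * suppPow σ (1 / 2))ᴴ * (suppPow ρ 0 * suppPow σ (1 / 2))).trace =
      (suppPow ρ 0 * σ).trace := by
    rw [Matrix.conjTranspose_mul, (suppPow_isHermitian ρ _).eq, (suppPow_isHermitian σ _).eq,
      Matrix.mul_assoc, ← Matrix.mul_assoc (suppPow ρ 0), suppPow_zero_mul hρ.1,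
      Matrix.trace_mul_comm, Matrix.mul_assoc, suppPow_half_mul_self hσ]
  have h5 := trace_conjTranspose_mul_self_re_nonneg (suppPow ρ 0 * suppPow σ (1 / 2))
  rw [h4] at h2 h5
  rw [fidelity, h, h1, ← Real.sq_sqrt h5]
  gcongr
  calc _ ≤ _ := h2
    _ ≤ 1 * √((suppPow ρ 0 * σ).trace.re) := by
      gcongr
      exact Real.sqrt_le_one.2 h3
    _ = _ := one_mul _

/-! ### The three lines argument -/

theorem exp_smul_add (X : Matrix n n ℂ) (z w : ℂ) :
    NormedSpace.exp ((z + w) • X) = NormedSpace.exp (z • X) * NormedSpace.exp (w • X) := by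
  rw [add_smul, Matrix.exp_add_of_commute _ _
    (((Commute.refl X).smul_left z).smul_right w)]

theorem norm_exp_smul_le_one {X : Matrix n n ℂ} (hX : X.IsHermitian) {z : ℂ} (hz : z.re = 0) :
    ‖NormedSpace.exp (z • X)‖ ≤ 1 :=
  norm_le_one_of_mem_unitaryGroup (exp_I_smul_mem_unitaryGroup hX hz)

/-- The imaginary part of `z` contributes only a unitary, so compactness of `[0, 1]` bounds the
whole strip. -/
theorem exists_norm_exp_smul_le {X : Matrix n n ℂ} (hX : X.IsHermitian) :
    ∃ C : ℝ, 0 ≤ C ∧ ∀ z : ℂ, z.re ∈ Set.Icc (0 : ℝ) 1 → ‖NormedSpace.exp (z • X)‖ ≤ C := by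
  have hc : Continuous fun r : ℝ => ‖NormedSpace.exp ((r : ℂ) • X)‖ := by
    have : Continuous fun z : ℂ => NormedSpace.exp (z • X) :=
      continuous_iff_continuousAt.2 fun z => (hasDerivAt_exp_smul_const X z).continuousAt
    exact (this.comp Complex.continuous_ofReal).norm
  obtain ⟨C, hC⟩ := (isCompact_Icc.image hc : IsCompact (_ '' Set.Icc (0 : ℝ) 1)).bddAbove
  refine ⟨C, ?_, fun z hz => ?_⟩
  · exact (norm_nonneg _).trans (hC ⟨0, by simp, rfl⟩)
  · have h1 : z = (z.re : ℂ) + (z.im * Complex.I) := (Complex.re_add_im z).symm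
    rw [h1, exp_smul_add]
    refine (norm_mul_le _ _).trans ?_
    have h2 := norm_exp_smul_le_one hX (z := z.im * Complex.I) (by simp)
    have h3 : ‖NormedSpace.exp ((z.re : ℂ) • X)‖ ≤ C := hC ⟨z.re, hz, rfl⟩
    calc _ ≤ C * 1 := mul_le_mul h3 h2 (norm_nonneg _) ((norm_nonneg _).trans h3)
      _ = C := mul_one C

/-- A holomorphic function on the strip that is `1` at `0`, bounded by `1` on the imaginary axis and
by `M` on the line of real part `1`, has a derivative of real part at most `log M` at `0`. -/
theorem re_deriv_le_log_of_strip {h : ℂ → ℂ} {h' : ℂ} {M : ℝ} (hM : 0 < M)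
    (hd : Differentiable ℂ h) (hder : HasDerivAt h h' 0) (h0 : h 0 = 1)
    (hB : ∃ C, ∀ z : ℂ, z.re ∈ Set.Icc (0 : ℝ) 1 → ‖h z‖ ≤ C)
    (hl : ∀ z : ℂ, z.re = 0 → ‖h z‖ ≤ 1) (hr : ∀ z : ℂ, z.re = 1 → ‖h z‖ ≤ M) :
    h'.re ≤ Real.log M := by
  have hle : ∀ θ ∈ Set.Icc (0 : ℝ) 1, (h θ).re ≤ M ^ θ := fun θ hθ => by
    have h1 := Complex.HadamardThreeLines.norm_le_interp_of_mem_verticalClosedStrip₀₁' h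
      (z := (θ : ℂ)) (a := 1) (b := M) (by simpa [Complex.HadamardThreeLines.verticalClosedStrip]
        using hθ) hd.diffContOnCl
      (by
        obtain ⟨C, hC⟩ := hB
        refine ⟨C, ?_⟩
        rintro _ ⟨z, hz, rfl⟩
        exact hC z hz)
      (fun z hz => hl z hz) (fun z hz => hr z hz)
    rw [Real.one_rpow, one_mul, Complex.ofReal_re] at h1
    exact (Complex.re_le_norm _).trans h1
  -- This difference vanishes at `0` and is nonpositive on `[0, 1]`, so its derivative at `0` is
  -- nonpositive.
  have hg : HasDerivAt (fun θ : ℝ => (h θ).re - M ^ θ) (h'.re - Real.log M) 0 := by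
    have h1 : HasDerivAt (fun θ : ℝ => (h θ).re) h'.re 0 :=
      HasDerivAt.real_of_complex (by simpa using hder)
    have h2 : HasDerivAt (fun θ : ℝ => M ^ θ) (Real.log M) 0 := by
      simpa using (hasDerivAt_id (0 : ℝ)).const_rpow hM
    exact h1.sub h2
  have ht := (hasDerivAt_iff_tendsto_slope.1 hg).mono_left
    (nhdsWithin_mono (0 : ℝ) (fun x (hx : 0 < x) => ne_of_gt hx) :
      nhdsWithin (0 : ℝ) (Set.Ioi 0) ≤ _)
  have h3 : h'.re - Real.log M ≤ 0 := by
    refine le_of_tendsto ht ?_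
    filter_upwards [Ioo_mem_nhdsGT (zero_lt_one (α := ℝ))] with θ hθ
    rw [slope_def_field]
    refine div_nonpos_of_nonpos_of_nonneg ?_ (by linarith [hθ.1])
    have := hle θ ⟨hθ.1.le, hθ.2.le⟩
    simp [h0, this]
  linarith

/-- Three lines for a product of four exponentials. The `Qᵢ` will be support projections, which turn
exponentials of logarithms into powers on the support. They fix `S` from both sides, so they
disappear from the value and the derivative at `0`. The last factor needs none: in the applications
it belongs to `ρ`, and `S = √ρ` stands next to it. -/
theorem re_trace_le_log_of_strip {S X₁ X₂ X₃ X₄ Q₁ Q₂ Q₃ : Matrix n n ℂ}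
    (hS : S.IsHermitian) (htr : (S * S).trace = 1)
    (hX₁ : X₁.IsHermitian) (hX₂ : X₂.IsHermitian) (hX₃ : X₃.IsHermitian) (hX₄ : X₄.IsHermitian)
    (hn₁ : ‖Q₁‖ ≤ 1) (hn₂ : ‖Q₂‖ ≤ 1) (hn₃ : ‖Q₃‖ ≤ 1)
    (hQ₁ : Q₁ * S = S) (hQ₂ : Q₂ * S = S) (hQ₃ : Q₃ * S = S)
    (hQ₁' : S * Q₁ = S) (hQ₂' : S * Q₂ = S) (hQ₃' : S * Q₃ = S)
    {M : ℝ} (hM : 0 < M)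
    (h : ∀ z : ℂ, z.re = 1 → ‖(S * (NormedSpace.exp (z • X₁) * Q₁ *
      (NormedSpace.exp (z • X₂) * Q₂) * (NormedSpace.exp (z • X₃) * Q₃) *
      NormedSpace.exp (z • X₄)) * S).trace‖ ≤ M) :
    ((S * S) * (X₁ + X₂ + X₃ + X₄)).trace.re ≤ Real.log M := by
  set G : ℂ → Matrix n n ℂ := fun z => NormedSpace.exp (z • X₁) * Q₁ *
      (NormedSpace.exp (z • X₂) * Q₂) * (NormedSpace.exp (z • X₃) * Q₃) *
      NormedSpace.exp (z • X₄) with hG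
  have hder : ∀ z, ∃ D, HasDerivAt (fun z => (S * G z * S).trace) D z ∧
      (z = 0 → D = ((S * S) * (X₁ + X₂ + X₃ + X₄)).trace) := by
    intro z
    have h1 := (hasDerivAt_exp_smul_const (𝕂 := ℂ) X₁ z).mul_const Q₁
    have h2 := (hasDerivAt_exp_smul_const (𝕂 := ℂ) X₂ z).mul_const Q₂
    have h3 := (hasDerivAt_exp_smul_const (𝕂 := ℂ) X₃ z).mul_const Q₃
    have h4 := hasDerivAt_exp_smul_const (𝕂 := ℂ) X₄ z
    have h5 := ((((h1.mul h2).mul h3).mul h4).const_mul S).mul_const S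
    refine ⟨_, (LinearMap.toContinuousLinearMap
      (Matrix.traceLinearMap n ℂ ℂ)).hasFDerivAt.comp_hasDerivAt z h5, ?_⟩
    rintro rfl
    have e : ∀ Y : Matrix n n ℂ, (S * S * Y).trace = (S * Y * S).trace := fun Y => by
      rw [Matrix.mul_assoc, Matrix.trace_mul_comm]
    rw [e]
    simp only [Pi.mul_apply, zero_smul, NormedSpace.exp_zero, one_mul, mul_one,
      LinearMap.coe_toContinuousLinearMap', Matrix.traceLinearMap_apply]
    congr 1
    -- In each term of the product rule, the projections right of `Xᵢ` are absorbed by the right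
    -- `S`, those left of it by the left `S`.
    simp only [mul_add, add_mul, Matrix.mul_assoc, hQ₁, hQ₂, hQ₃]
    simp only [← Matrix.mul_assoc, hQ₁', hQ₂', hQ₃']
  choose D hD hD0 using hder
  have hnorm : ∀ z, ‖(S * G z * S).trace‖ ≤ ‖NormedSpace.exp (z • X₁)‖ *
      ‖NormedSpace.exp (z • X₂)‖ * ‖NormedSpace.exp (z • X₃)‖ * ‖NormedSpace.exp (z • X₄)‖ := by
    intro z
    have h1 : (S * G z * S).trace = (G z * (Sᴴ * S)).trace := by
      rw [hS.eq, Matrix.trace_mul_comm, ← Matrix.mul_assoc, Matrix.trace_mul_comm]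
    rw [h1]
    refine (norm_trace_mul_conjTranspose_mul_self_le _ _).trans ?_
    rw [hS.eq, htr, Complex.one_re, mul_one]
    have e : ∀ Y Q : Matrix n n ℂ, ‖Q‖ ≤ 1 → ‖Y * Q‖ ≤ ‖Y‖ := fun Y Q hQ =>
      (norm_mul_le _ _).trans (mul_le_of_le_one_right (norm_nonneg _) hQ)
    refine (norm_mul_le _ _).trans ?_
    gcongr
    refine (norm_mul_le _ _).trans ?_
    gcongr
    · refine (norm_mul_le _ _).trans ?_
      gcongr
      · exact e _ _ hn₁
      · exact e _ _ hn₂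
    · exact e _ _ hn₃
  have hG0 : (S * G 0 * S).trace = 1 := by
    simp only [hG, zero_smul, NormedSpace.exp_zero, one_mul, mul_one, Matrix.mul_assoc, hQ₁, hQ₂,
      hQ₃, htr]
  rw [← hD0 0 rfl]
  refine re_deriv_le_log_of_strip hM (fun z => (hD z).differentiableAt) (hD 0) hG0 ?_ ?_ h
  · obtain ⟨C₁, hC₁, b₁⟩ := exists_norm_exp_smul_le hX₁
    obtain ⟨C₂, hC₂, b₂⟩ := exists_norm_exp_smul_le hX₂
    obtain ⟨C₃, hC₃, b₃⟩ := exists_norm_exp_smul_le hX₃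
    obtain ⟨C₄, hC₄, b₄⟩ := exists_norm_exp_smul_le hX₄
    refine ⟨C₁ * C₂ * C₃ * C₄, fun z hz => (hnorm z).trans ?_⟩
    have := b₁ z hz
    have := b₂ z hz
    have := b₃ z hz
    have := b₄ z hz
    gcongr
  · intro z hz
    refine (hnorm z).trans ?_
    have := norm_exp_smul_le_one hX₁ hz
    have := norm_exp_smul_le_one hX₂ hz
    have := norm_exp_smul_le_one hX₃ hz
    have := norm_exp_smul_le_one hX₄ hz
    calc _ ≤ (1 : ℝ) * 1 * 1 * 1 := by gcongr
      _ = 1 := by norm_num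

/-! ### Embeddings of subsystems and marginals -/

/-- The embedding `X ↦ 1 ⊗ X`. -/
def oneKron (n m : Type*) [Fintype n] [DecidableEq n] [Fintype m] [DecidableEq m] :
    Matrix m m ℂ →⋆ₐ[ℂ] Matrix (n × m) (n × m) ℂ where
  toFun X := (1 : Matrix n n ℂ) ⊗ₖ X
  map_one' := Matrix.one_kronecker_one
  map_mul' X Y := by rw [← Matrix.mul_kronecker_mul, one_mul]
  map_zero' := Matrix.kronecker_zero _
  map_add' X Y := Matrix.kronecker_add _ _ _
  commutes' r := by
    simp only [Algebra.algebraMap_eq_smul_one, Matrix.kronecker_smul, Matrix.one_kronecker_one]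
  map_star' X := by
    simp only [Matrix.star_eq_conjTranspose, Matrix.conjTranspose_kronecker,
      Matrix.conjTranspose_one]

/-- The embedding of operators on `AC` into operators on `ABC`. -/
def embedAC (a b c : Type*) [Fintype a] [DecidableEq a] [Fintype b] [DecidableEq b] [Fintype c]
    [DecidableEq c] : Matrix (a × c) (a × c) ℂ →⋆ₐ[ℂ] Matrix (a × b × c) (a × b × c) ℂ where
  toFun X := Matrix.of fun p q => if p.2.1 = q.2.1 then X (p.1, p.2.2) (q.1, q.2.2) else 0
  map_one' := by
    ext ⟨i, j, k⟩ ⟨i', j', k'⟩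
    simp only [Matrix.of_apply, Matrix.one_apply, Prod.mk.injEq]
    grind
  map_mul' X Y := by
    ext ⟨i, j, k⟩ ⟨i', j', k'⟩
    simp only [Matrix.of_apply, Matrix.mul_apply, Fintype.sum_prod_type]
    have h : ∀ i₁ : a, (∑ j₁ : b, ∑ k₁ : c, (if j = j₁ then X (i, k) (i₁, k₁) else 0) *
        (if j₁ = j' then Y (i₁, k₁) (i', k') else 0)) =
        if j = j' then ∑ k₁ : c, X (i, k) (i₁, k₁) * Y (i₁, k₁) (i', k') else 0 := fun i₁ => by
      rw [Finset.sum_comm]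
      by_cases hj : j = j' <;> simp [hj]
    simp only [h]
    by_cases hj : j = j' <;> simp [hj]
  map_zero' := by ext; simp
  map_add' X Y := by ext; simp [ite_add_zero]
  commutes' r := by
    ext ⟨i, j, k⟩ ⟨i', j', k'⟩
    simp only [Algebra.algebraMap_eq_smul_one, Matrix.smul_apply, Matrix.of_apply,
      Matrix.one_apply, Prod.mk.injEq]
    by_cases h : j = j' <;> simp [h]
  map_star' X := by
    ext ⟨i, j, k⟩ ⟨i', j', k'⟩
    simp only [Matrix.star_eq_conjTranspose, Matrix.of_apply, Matrix.conjTranspose_apply]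
    split_ifs with h1 h2 h2 <;> first | rfl | simp_all

theorem embedAC_mul_apply (M : Matrix (a × c) (a × c) ℂ) (Z : Matrix (a × b × c) n ℂ)
    (i : a) (j : b) (k : c) (q : n) :
    (embedAC a b c M * Z) (i, j, k) q = ∑ r : a × c, M (i, k) r * Z (r.1, j, r.2) q := by
  simp only [embedAC, Matrix.mul_apply, Fintype.sum_prod_type]
  refine Finset.sum_congr rfl fun i' _ => ?_
  rw [Finset.sum_comm]
  simp

theorem mul_embedAC_apply (M : Matrix (a × c) (a × c) ℂ) (Z : Matrix n (a × b × c) ℂ)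
    (i : a) (j : b) (k : c) (p : n) :
    (Z * embedAC a b c M) p (i, j, k) = ∑ r : a × c, Z p (r.1, j, r.2) * M r (i, k) := by
  simp only [embedAC, Matrix.mul_apply, Fintype.sum_prod_type]
  refine Finset.sum_congr rfl fun i' _ => ?_
  rw [Finset.sum_comm]
  simp

theorem embedAC_oneKron (X : Matrix c c ℂ) :
    embedAC a b c (oneKron a c X) = oneKron a (b × c) (oneKron b c X) := by
  ext ⟨i, j, k⟩ ⟨i', j', k'⟩
  simp only [embedAC, oneKron, StarAlgHom.coe_mk', AlgHom.coe_mk, RingHom.coe_mk, MonoidHom.coe_mk,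
    OneHom.coe_mk, Matrix.of_apply, Matrix.kronecker_apply, Matrix.one_apply]
  by_cases h : j = j' <;> by_cases h' : i = i' <;> simp [h, h']

/-- An embedded operator on `AC` is block diagonal in the `B` index, so it acts on each block
`X_{jj'}` separately. -/
theorem applyToC_sandwich (M N : Matrix (a × c) (a × c) ℂ) (Y : Matrix (b × c) (b × c) ℂ) :
    applyToC (fun X => M * ((1 : Matrix a a ℂ) ⊗ₖ X) * N) Y =
      embedAC a b c M * oneKron a (b × c) Y * embedAC a b c N := by
  ext ⟨i, j, k⟩ ⟨i', j', k'⟩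
  rw [mul_embedAC_apply]
  simp only [applyToC, Matrix.of_apply, embedAC_mul_apply]
  rw [Matrix.mul_apply]
  simp only [Matrix.mul_apply]
  rfl

/-- The partial trace is dual to the embedding. This identity and its analogues for `BC` and `C`
yield the support inclusions, the entropy terms and the positive definiteness of the embedded
marginals. -/
theorem trace_embedAC_mul (ρ : Matrix (a × b × c) (a × b × c) ℂ) (X : Matrix (a × c) (a × c) ℂ) :
    (embedAC a b c X * ρ).trace = (X * margAC ρ).trace := by
  simp only [Matrix.trace, Matrix.diag, Fintype.sum_prod_type, embedAC_mul_apply]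
  simp only [Matrix.mul_apply, Fintype.sum_prod_type, margAC, Matrix.of_apply, Finset.mul_sum]
  refine Finset.sum_congr rfl fun i _ => ?_
  rw [Finset.sum_comm]
  refine Finset.sum_congr rfl fun k _ => ?_
  rw [Finset.sum_comm]
  refine Finset.sum_congr rfl fun i' _ => ?_
  rw [Finset.sum_comm]

theorem oneKron_mul_apply (M : Matrix m m ℂ) (Z : Matrix (n × m) (n × m) ℂ)
    (i : n) (k : m) (q : n × m) :
    (oneKron n m M * Z) (i, k) q = ∑ r : m, M k r * Z (i, r) q := by
  simp only [oneKron, StarAlgHom.coe_mk', AlgHom.coe_mk, RingHom.coe_mk, MonoidHom.coe_mk,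
    OneHom.coe_mk, Matrix.mul_apply, Matrix.kronecker_apply, Matrix.one_apply,
    Fintype.sum_prod_type]
  rw [Finset.sum_comm]
  simp

theorem trace_oneKron_mul (ρ : Matrix (n × m) (n × m) ℂ) (X : Matrix m m ℂ) :
    (oneKron n m X * ρ).trace =
      (X * Matrix.of fun k l => ∑ i, ρ (i, k) (i, l)).trace := by
  simp only [Matrix.trace, Matrix.diag, Fintype.sum_prod_type, oneKron_mul_apply]
  simp only [Matrix.mul_apply, Matrix.of_apply, Finset.mul_sum]
  rw [Finset.sum_comm]
  refine Finset.sum_congr rfl fun k _ => ?_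
  rw [Finset.sum_comm]

/-- The embedding of operators on `BC` into operators on `ABC`. -/
def embedBC (a b c : Type*) [Fintype a] [DecidableEq a] [Fintype b] [DecidableEq b] [Fintype c]
    [DecidableEq c] : Matrix (b × c) (b × c) ℂ →⋆ₐ[ℂ] Matrix (a × b × c) (a × b × c) ℂ :=
  oneKron a (b × c)

/-- The embedding of operators on `C` into operators on `ABC`. -/
def embedC (a b c : Type*) [Fintype a] [DecidableEq a] [Fintype b] [DecidableEq b] [Fintype c]
    [DecidableEq c] : Matrix c c ℂ →⋆ₐ[ℂ] Matrix (a × b × c) (a × b × c) ℂ :=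
  (oneKron a (b × c)).comp (oneKron b c)

theorem trace_embedBC_mul (ρ : Matrix (a × b × c) (a × b × c) ℂ) (X : Matrix (b × c) (b × c) ℂ) :
    (embedBC a b c X * ρ).trace = (X * margBC ρ).trace :=
  trace_oneKron_mul ρ X

theorem trace_embedC_mul (ρ : Matrix (a × b × c) (a × b × c) ℂ) (X : Matrix c c ℂ) :
    (embedC a b c X * ρ).trace = (X * margC ρ).trace := by
  refine (trace_oneKron_mul ρ _).trans ((trace_oneKron_mul _ X).trans ?_)
  congr 2
  ext k l
  simp only [Matrix.of_apply, margC]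
  rw [Finset.sum_comm]

theorem margAC_posSemidef {ρ : Matrix (a × b × c) (a × b × c) ℂ} (hρ : ρ.PosSemidef) :
    (margAC ρ).PosSemidef := by
  have : margAC ρ = ∑ j : b, ρ.submatrix (fun p : a × c => (p.1, j, p.2)) (fun p => (p.1, j, p.2)) := by
    ext p q
    simp [margAC, Matrix.sum_apply]
  rw [this]
  exact Matrix.posSemidef_sum _ fun j _ => hρ.submatrix _

theorem margBC_posSemidef {ρ : Matrix (a × b × c) (a × b × c) ℂ} (hρ : ρ.PosSemidef) :
    (margBC ρ).PosSemidef := by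
  have : margBC ρ = ∑ i : a, ρ.submatrix (fun p : b × c => (i, p)) (fun p => (i, p)) := by
    ext p q
    simp [margBC, Matrix.sum_apply]
  rw [this]
  exact Matrix.posSemidef_sum _ fun j _ => hρ.submatrix _

theorem margC_posSemidef {ρ : Matrix (a × b × c) (a × b × c) ℂ} (hρ : ρ.PosSemidef) :
    (margC ρ).PosSemidef := by
  have : margC ρ = ∑ i : a, ∑ j : b, ρ.submatrix (fun k : c => (i, j, k)) (fun k => (i, j, k)) := by
    ext p q
    simp [margC, Matrix.sum_apply]
  rw [this]
  exact Matrix.posSemidef_sum _ fun i _ => Matrix.posSemidef_sum _ fun j _ => hρ.submatrix _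

theorem map_posSemidef (φ : Matrix m m ℂ →⋆ₐ[ℂ] Matrix n n ℂ) {A : Matrix m m ℂ}
    (hA : A.PosSemidef) : (φ A).PosSemidef := by
  rw [← suppPow_half_mul_self hA, map_mul]
  nth_rewrite 1 [← (suppPow_isHermitian A (1 / 2)).eq]
  rw [← Matrix.star_eq_conjTranspose, map_star, Matrix.star_eq_conjTranspose]
  exact Matrix.posSemidef_conjTranspose_mul_self _

theorem continuous_starAlgHom (φ : Matrix m m ℂ →⋆ₐ[ℂ] Matrix n n ℂ) : Continuous φ :=
  φ.toAlgHom.toLinearMap.continuous_of_finiteDimensional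

theorem map_mem_unitaryGroup (φ : Matrix m m ℂ →⋆ₐ[ℂ] Matrix n n ℂ) {U : Matrix m m ℂ}
    (hU : U ∈ Matrix.unitaryGroup m ℂ) : φ U ∈ Matrix.unitaryGroup n ℂ := by
  rw [Matrix.mem_unitaryGroup_iff] at *
  rw [← map_star, ← map_mul, hU, map_one]

/-- The support of a density operator lies in the support of its marginal. -/
theorem suppPow_zero_map_mul (φ : Matrix m m ℂ →⋆ₐ[ℂ] Matrix n n ℂ) {σ : Matrix m m ℂ}
    {ρ : Matrix n n ℂ} (hσ : σ.PosSemidef) (hρ : ρ.PosSemidef)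
    (h : ∀ X, (φ X * ρ).trace = (X * σ).trace) :
    suppPow (φ σ) 0 * suppPow ρ (1 / 2) = suppPow ρ (1 / 2) := by
  refine suppPow_zero_mul_of_trace_eq (σ := ρ) (map_posSemidef φ hσ) ?_ ?_
  · rw [(suppPow_isHermitian ρ _).eq, suppPow_half_mul_self hρ]
  -- By duality the weight of `ρ` outside the embedded support equals the weight of `σ` outside its
  -- own support, which is zero.
  · rw [← map_suppPow φ 0 hσ.isHermitian, ← map_one φ, ← map_sub, h, sub_mul, one_mul,
      suppPow_zero_mul_self hσ, sub_self, Matrix.trace_zero]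

theorem trace_mul_log_map (φ : Matrix m m ℂ →⋆ₐ[ℂ] Matrix n n ℂ) {σ : Matrix m m ℂ}
    {ρ : Matrix n n ℂ} (hσ : σ.PosSemidef) (h : ∀ X, (φ X * ρ).trace = (X * σ).trace) :
    (ρ * onSupport Real.log (φ σ)).trace.re = - entropy σ := by
  rw [← map_onSupport φ _ hσ.isHermitian, Matrix.trace_mul_comm, h, entropy, neg_neg,
    Matrix.trace_mul_comm]

/-- The operator `K` with `R^{V,W}(ρ_BC) = K Kᴴ`. -/
noncomputable def recoveryFactor (ρ : Matrix (a × b × c) (a × b × c) ℂ) (V : Matrix (a × c) (a × c) ℂ)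
    (W : Matrix c c ℂ) : Matrix (a × b × c) (a × b × c) ℂ :=
  embedAC a b c V * suppPow (embedAC a b c (margAC ρ)) (1 / 2) *
    suppPow (embedC a b c (margC ρ)) (-1 / 2) * embedC a b c W *
    suppPow (embedBC a b c (margBC ρ)) (1 / 2)

theorem recovered_eq {ρ : Matrix (a × b × c) (a × b × c) ℂ} (hρ : ρ.PosSemidef)
    (V : Matrix (a × c) (a × c) ℂ) (W : Matrix c c ℂ) :
    recovered ρ V W = recoveryFactor ρ V W * (recoveryFactor ρ V W)ᴴ := by
  have hA := margAC_posSemidef hρ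
  have hB := margBC_posSemidef hρ
  have hC := margC_posSemidef hρ
  -- `N` is the operator for which the swiveled Petz map reads `X ↦ N (1 ⊗ X) Nᴴ`; then `K` is the
  -- embedded `N` times `√ρ_BC`.
  set N : Matrix (a × c) (a × c) ℂ := V * suppPow (margAC ρ) (1 / 2) *
    oneKron a c (suppPow (margC ρ) (-1 / 2) * W) with hN
  have h1 : swiveledPetzMap ρ V W = fun X => N * ((1 : Matrix a a ℂ) ⊗ₖ X) * Nᴴ := by
    funext X
    have e : ∀ Y : Matrix c c ℂ, (1 : Matrix a a ℂ) ⊗ₖ Y = oneKron a c Y := fun _ => rfl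
    have e2 : (oneKron a c (suppPow (margC ρ) (-1 / 2) * W))ᴴ =
        oneKron a c (Wᴴ * suppPow (margC ρ) (-1 / 2)) := by
      rw [← Matrix.star_eq_conjTranspose, ← map_star, Matrix.star_eq_conjTranspose,
        Matrix.conjTranspose_mul, (suppPow_isHermitian _ _).eq]
    simp only [swiveledPetzMap, conjBy, petzMap, e, hN, Matrix.conjTranspose_mul, e2,
      (suppPow_isHermitian _ _).eq]
    simp only [map_mul, Matrix.mul_assoc]
  have h2 : embedAC a b c N * suppPow (embedBC a b c (margBC ρ)) (1 / 2) =
      recoveryFactor ρ V W := by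
    have e : ∀ Y : Matrix c c ℂ, embedAC a b c (oneKron a c Y) = embedC a b c Y := embedAC_oneKron
    rw [hN, recoveryFactor, map_mul, map_mul, e, map_mul, map_suppPow _ _ hA.isHermitian,
      map_suppPow _ _ hC.isHermitian]
    simp only [Matrix.mul_assoc]
  have h3 : embedAC a b c Nᴴ = (embedAC a b c N)ᴴ := map_star _ _
  have h4 : oneKron a (b × c) (margBC ρ) = suppPow (embedBC a b c (margBC ρ)) (1 / 2) *
      suppPow (embedBC a b c (margBC ρ)) (1 / 2) :=
    (suppPow_half_mul_self (map_posSemidef _ hB)).symm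
  rw [recovered, h1, applyToC_sandwich, ← h2,
    Matrix.conjTranspose_mul (embedAC a b c N), (suppPow_isHermitian _ _).eq, h3, h4]
  simp only [Matrix.mul_assoc]

theorem continuous_recovered {ρ : Matrix (a × b × c) (a × b × c) ℂ} (hρ : ρ.PosSemidef) :
    Continuous fun p : Matrix (a × c) (a × c) ℂ × Matrix c c ℂ => recovered ρ p.1 p.2 := by
  have h : Continuous fun p : Matrix (a × c) (a × c) ℂ × Matrix c c ℂ =>
      recoveryFactor ρ p.1 p.2 := by
    have h1 := (continuous_starAlgHom (embedAC a b c)).comp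
      (continuous_fst (X := Matrix (a × c) (a × c) ℂ) (Y := Matrix c c ℂ))
    have h2 := (continuous_starAlgHom (embedC a b c)).comp
      (continuous_snd (X := Matrix (a × c) (a × c) ℂ) (Y := Matrix c c ℂ))
    exact (((h1.mul continuous_const).mul continuous_const).mul h2).mul continuous_const
  simp only [recovered_eq hρ]
  exact h.mul h.matrix_conjTranspose

/-! ### Compactness of the swivels -/

theorem isCompact_swivels (ω : Matrix n n ℂ) : IsCompact (swivels ω) := by
  have : ProperSpace (Matrix n n ℂ) := FiniteDimensional.proper ℂ _
  refine Metric.isCompact_of_isClosed_isBounded ?_ ?_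
  · refine IsClosed.inter ?_ ?_
    · exact isClosed_unitary
    · exact isClosed_eq (continuous_id.mul continuous_const) (continuous_const.mul continuous_id)
  · refine (Metric.isBounded_closedBall (x := (0 : Matrix n n ℂ)) (r := 1)).subset fun V hV => ?_
    rw [mem_closedBall_zero_iff]
    exact norm_le_one_of_mem_unitaryGroup hV.1

theorem one_mem_swivels (ω : Matrix n n ℂ) : (1 : Matrix n n ℂ) ∈ swivels ω :=
  ⟨one_mem _, Commute.one_left _⟩

/-- A continuous function on a compact set attains its maximum. The set `s` is needed because
continuity is only available on part of the matrices: the positive semi-definite ones for the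
fidelity, the positive definite ones for the inverse. -/
theorem exists_isGreatest_recoveryValues {T : Type*} [LinearOrder T] [TopologicalSpace T]
    [OrderClosedTopology T] {ρ : Matrix (a × b × c) (a × b × c) ℂ} (hρ : ρ.PosSemidef)
    {f : Matrix (a × b × c) (a × b × c) ℂ → T} {s : Set (Matrix (a × b × c) (a × b × c) ℂ)}
    (hf : ContinuousOn f s)
    (hs : ∀ V ∈ swivels (margAC ρ), ∀ W ∈ swivels (margC ρ), recovered ρ V W ∈ s) :
    ∃ t, IsGreatest (recoveryValues ρ f) t := by
  have hc := (isCompact_swivels (margAC ρ)).prod (isCompact_swivels (margC ρ))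
  obtain ⟨p, hp, hmax⟩ := hc.exists_isMaxOn ⟨(1, 1), one_mem_swivels _, one_mem_swivels _⟩
    (hf.comp (continuous_recovered hρ).continuousOn fun p hp => hs _ hp.1 _ hp.2)
  refine ⟨f (recovered ρ p.1 p.2), ⟨p.1, hp.1, p.2, hp.2, rfl⟩, ?_⟩
  rintro _ ⟨V, hV, W, hW, rfl⟩
  exact hmax (a := (V, W)) ⟨hV, hW⟩

/-! ### The recovery bounds at the level of operators -/

/-- The unitary `A ^ (i t)`, with value `1` on the kernel of `A`. -/
noncomputable def imagPow (A : Matrix n n ℂ) (t : ℝ) : Matrix n n ℂ :=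
  NormedSpace.exp ((t * Complex.I) • onSupport Real.log A)

theorem imagPow_mem_unitaryGroup (A : Matrix n n ℂ) (t : ℝ) :
    imagPow A t ∈ Matrix.unitaryGroup n ℂ :=
  exp_I_smul_mem_unitaryGroup (onSupport_isHermitian _ A) (by simp)

theorem norm_imagPow_le (A : Matrix n n ℂ) (t : ℝ) : ‖imagPow A t‖ ≤ 1 :=
  norm_le_one_of_mem_unitaryGroup (imagPow_mem_unitaryGroup A t)

theorem imagPow_commute {A X : Matrix n n ℂ} (h : Commute (onSupport Real.log A) X) (t : ℝ) :
    Commute (imagPow A t) X :=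
  (h.smul_left _).exp_left

theorem imagPow_mem_swivels {A : Matrix n n ℂ} (hA : A.IsHermitian) (t : ℝ) :
    imagPow A t ∈ swivels A :=
  ⟨imagPow_mem_unitaryGroup A t, imagPow_commute (onSupport_commute_self _ hA) t⟩

theorem imagPow_commute_suppPow (A : Matrix n n ℂ) (t r : ℝ) :
    Commute (imagPow A t) (suppPow A r) :=
  imagPow_commute (onSupport_commute _ _ A) t

theorem imagPow_neg_mul (A : Matrix n n ℂ) (t : ℝ) : imagPow A (-t) * imagPow A t = 1 := by
  rw [imagPow, imagPow, ← exp_smul_add, ← add_mul]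
  simp

theorem map_imagPow (φ : Matrix m m ℂ →⋆ₐ[ℂ] Matrix n n ℂ) {A : Matrix m m ℂ}
    (hA : A.IsHermitian) (t : ℝ) : φ (imagPow A t) = imagPow (φ A) t := by
  rw [imagPow, imagPow, ← map_onSupport φ _ hA, ← map_smul]
  exact NormedSpace.map_exp_of_mem_ball (𝕂 := ℂ) φ (continuous_starAlgHom φ) _
    ((NormedSpace.expSeries_radius_eq_top ℂ (Matrix m m ℂ)).symm ▸ edist_lt_top _ _)

/-- Splits `A^z` into a unitary and a real power. The projection removes the kernel of `A`, on which
the exponential is the identity. -/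
theorem exp_smul_log_mul {A : Matrix n n ℂ} (hA : A.PosSemidef) (z : ℂ) :
    NormedSpace.exp (z • onSupport Real.log A) * suppPow A 0 =
      imagPow A z.im * suppPow A z.re := by
  have hz : z = z.im * Complex.I + z.re := by rw [add_comm]; exact (Complex.re_add_im z).symm
  rw [imagPow, ← exp_smul_log_mul_suppPow_zero hA z.re, ← Matrix.mul_assoc, ← exp_smul_add, ← hz]

theorem isHermitian_real_smul {X : Matrix n n ℂ} (hX : X.IsHermitian) (r : ℝ) :
    ((r : ℂ) • X).IsHermitian := by
  rw [Matrix.IsHermitian, Matrix.conjTranspose_smul, hX.eq]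
  simp

theorem mul_suppPow_zero {A S : Matrix n n ℂ}
    (hS : S.IsHermitian) (h : suppPow A 0 * S = S) : S * suppPow A 0 = S := by
  have := congrArg Matrix.conjTranspose h
  rwa [Matrix.conjTranspose_mul, hS.eq, (suppPow_isHermitian A 0).eq] at this

/-- The sum of the `Tr {ρ log ·}` that gives minus the conditional mutual information. -/
noncomputable def logTrace (ρ A B C : Matrix n n ℂ) : ℝ :=
  (ρ * onSupport Real.log A).trace.re + (ρ * onSupport Real.log B).trace.re -
    (ρ * onSupport Real.log C).trace.re - (ρ * onSupport Real.log ρ).trace.re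

theorem logTrace_le_log_of_fidelity_le {ρ A B C : Matrix n n ℂ} (hρ : IsDensity ρ)
    (hA : A.PosSemidef) (hB : B.PosSemidef) (hC : C.PosSemidef)
    (sA : suppPow A 0 * suppPow ρ (1 / 2) = suppPow ρ (1 / 2))
    (sB : suppPow B 0 * suppPow ρ (1 / 2) = suppPow ρ (1 / 2))
    (sC : suppPow C 0 * suppPow ρ (1 / 2) = suppPow ρ (1 / 2)) {M : ℝ} (hM : 0 < M)
    (h : ∀ t : ℝ, fidelity ρ
      ((imagPow A t * suppPow A (1 / 2) * suppPow C (-1 / 2) * imagPow C (-t) * suppPow B (1 / 2)) *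
      (imagPow A t * suppPow A (1 / 2) * suppPow C (-1 / 2) * imagPow C (-t) *
        suppPow B (1 / 2))ᴴ) ≤ M) :
    logTrace ρ A B C ≤ Real.log M := by
  have hS := suppPow_isHermitian ρ (1 / 2)
  have hSS := suppPow_half_mul_self hρ.1
  have key := re_trace_le_log_of_strip hS (by rw [hSS, hρ.2])
    (isHermitian_real_smul (onSupport_isHermitian Real.log A) (1 / 2))
    (isHermitian_real_smul (onSupport_isHermitian Real.log C) (-1 / 2))
    (isHermitian_real_smul (onSupport_isHermitian Real.log B) (1 / 2))
    (isHermitian_real_smul (onSupport_isHermitian Real.log ρ) (-1 / 2))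
    (norm_suppPow_zero_le hA) (norm_suppPow_zero_le hC) (norm_suppPow_zero_le hB)
    sA sC sB (mul_suppPow_zero hS sA) (mul_suppPow_zero hS sC) (mul_suppPow_zero hS sB)
    (Real.sqrt_pos.2 hM) ?_
  · rw [hSS, Real.log_sqrt hM.le] at key
    simp only [mul_add, Matrix.trace_add, Matrix.mul_smul, Matrix.trace_smul, Complex.add_re,
      smul_eq_mul, Complex.re_ofReal_mul] at key
    rw [logTrace]
    linarith
  · intro z hz
    -- The exponents are `± z / 2`, so the swivel parameter is half the height of `z`.
    set t := z.im / 2 with ht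
    have e1 : ∀ X : Matrix n n ℂ, X.PosSemidef → NormedSpace.exp (z • ((1 / 2 : ℝ) : ℂ) •
        onSupport Real.log X) * suppPow X 0 = imagPow X t * suppPow X (1 / 2) := fun X hX => by
      rw [smul_smul, exp_smul_log_mul hX]
      congr 2
      · rw [Complex.im_mul_ofReal, ht]; ring
      · rw [Complex.re_mul_ofReal, hz]; ring
    have e2 : ∀ X : Matrix n n ℂ, X.PosSemidef → NormedSpace.exp (z • ((-1 / 2 : ℝ) : ℂ) •
        onSupport Real.log X) * suppPow X 0 = suppPow X (-1 / 2) * imagPow X (-t) := fun X hX => by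
      rw [smul_smul, exp_smul_log_mul hX, (imagPow_commute_suppPow X _ _).eq]
      congr 2
      · rw [Complex.re_mul_ofReal, hz]; ring
      · rw [Complex.im_mul_ofReal, ht]; ring
    -- On `Re z = 1` the factor `ρ^(-1/2)` cancels `√ρ` and leaves a contraction.
    have e3 : NormedSpace.exp (z • ((-1 / 2 : ℝ) : ℂ) • onSupport Real.log ρ) *
        suppPow ρ (1 / 2) = imagPow ρ (-t) * suppPow ρ 0 := by
      rw [← suppPow_zero_mul hρ.1, ← Matrix.mul_assoc, e2 ρ hρ.1,
        ← (imagPow_commute_suppPow ρ _ _).eq, Matrix.mul_assoc, suppPow_mul hρ.1]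
      norm_num
    rw [e1 A hA, e1 B hB, e2 C hC, (imagPow_commute_suppPow B t (1 / 2)).eq]
    -- The unitary `B^(it)` is not part of `K`; having been moved past `√B`, it joins the
    -- contraction.
    have e4 := norm_trace_sq_le_fidelity ρ
      (imagPow A t * suppPow A (1 / 2) * suppPow C (-1 / 2) * imagPow C (-t) * suppPow B (1 / 2))
      (imagPow B t * (imagPow ρ (-t) * suppPow ρ 0)) ?_
    · refine Real.le_sqrt_of_sq_le (le_trans (le_of_eq ?_) (e4.trans (h t)))
      rw [← e3]
      simp only [Matrix.mul_assoc]
    · refine (norm_mul_le _ _).trans (mul_le_one₀ (norm_imagPow_le _ _) (norm_nonneg _) ?_)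
      exact (norm_mul_le _ _).trans (mul_le_one₀ (norm_imagPow_le _ _) (norm_nonneg _)
        (norm_suppPow_zero_le hρ.1))

theorem neg_logTrace_le_log_of_trace_le {ρ A B C : Matrix n n ℂ} (hρ : IsDensity ρ)
    (hA : A.PosDef) (hB : B.PosDef) (hC : C.PosDef) {M : ℝ} (hM : 0 < M)
    (h : ∀ t : ℝ, (ρ * ρ *
      ((imagPow A t * suppPow A (1 / 2) * suppPow C (-1 / 2) * imagPow C (-t) * suppPow B (1 / 2)) *
      (imagPow A t * suppPow A (1 / 2) * suppPow C (-1 / 2) * imagPow C (-t) *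
        suppPow B (1 / 2))ᴴ)⁻¹).trace.re ≤ M) :
    -logTrace ρ A B C ≤ Real.log M := by
  have hS := suppPow_isHermitian ρ (1 / 2)
  have hSS := suppPow_half_mul_self hρ.1
  have h1 : ‖(1 : Matrix n n ℂ)‖ ≤ 1 := norm_le_one_of_mem_unitaryGroup (one_mem _)
  have key := re_trace_le_log_of_strip (Q₁ := 1) (Q₂ := 1) (Q₃ := 1) hS (by rw [hSS, hρ.2])
    (isHermitian_real_smul (onSupport_isHermitian Real.log B) (-1 / 2))
    (isHermitian_real_smul (onSupport_isHermitian Real.log C) (1 / 2))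
    (isHermitian_real_smul (onSupport_isHermitian Real.log A) (-1 / 2))
    (isHermitian_real_smul (onSupport_isHermitian Real.log ρ) (1 / 2))
    h1 h1 h1 (one_mul _) (one_mul _) (one_mul _) (mul_one _) (mul_one _) (mul_one _)
    (Real.sqrt_pos.2 hM) ?_
  · rw [hSS, Real.log_sqrt hM.le] at key
    simp only [mul_add, Matrix.trace_add, Matrix.mul_smul, Matrix.trace_smul, Complex.add_re,
      smul_eq_mul, Complex.re_ofReal_mul] at key
    rw [logTrace]
    linarith
  · intro z hz
    set t := z.im / 2 with ht
    have e1 : ∀ X : Matrix n n ℂ, X.PosSemidef → NormedSpace.exp (z • ((1 / 2 : ℝ) : ℂ) •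
        onSupport Real.log X) * suppPow X 0 = imagPow X t * suppPow X (1 / 2) := fun X hX => by
      rw [smul_smul, exp_smul_log_mul hX]
      congr 2
      · rw [Complex.im_mul_ofReal, ht]; ring
      · rw [Complex.re_mul_ofReal, hz]; ring
    have e2 : ∀ X : Matrix n n ℂ, X.PosSemidef → NormedSpace.exp (z • ((-1 / 2 : ℝ) : ℂ) •
        onSupport Real.log X) * suppPow X 0 = imagPow X (-t) * suppPow X (-1 / 2) := fun X hX => by
      rw [smul_smul, exp_smul_log_mul hX]
      congr 2
      · rw [Complex.im_mul_ofReal, ht]; ring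
      · rw [Complex.re_mul_ofReal, hz]; ring
    have e3 : NormedSpace.exp (z • ((1 / 2 : ℝ) : ℂ) • onSupport Real.log ρ) *
        suppPow ρ (1 / 2) = ρ * imagPow ρ t := by
      rw [← suppPow_zero_mul hρ.1, ← Matrix.mul_assoc, e1 ρ hρ.1, Matrix.mul_assoc, hSS,
        (imagPow_commute (onSupport_commute_self _ hρ.1.isHermitian) t).eq]
    have e2A := e2 A hA.posSemidef
    have e2B := e2 B hB.posSemidef
    have e1C := e1 C hC.posSemidef
    rw [suppPow_zero_of_posDef hA, (imagPow_commute_suppPow A _ _).eq] at e2A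
    rw [suppPow_zero_of_posDef hB] at e2B
    rw [suppPow_zero_of_posDef hC] at e1C
    rw [e2A, e2B, e1C]
    have cancel : ∀ X : Matrix n n ℂ, X.PosDef → ∀ Y, suppPow X (-1 / 2) *
        (suppPow X (1 / 2) * Y) = Y := fun X hX Y => by
      rw [← Matrix.mul_assoc, suppPow_mul hX.posSemidef]
      norm_num [suppPow_zero_of_posDef hX]
    have cancel' : ∀ X : Matrix n n ℂ, X.PosDef → ∀ Y, suppPow X (1 / 2) *
        (suppPow X (-1 / 2) * Y) = Y := fun X hX Y => by
      rw [← Matrix.mul_assoc, suppPow_mul hX.posSemidef]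
      norm_num [suppPow_zero_of_posDef hX]
    have icancel : ∀ X : Matrix n n ℂ, ∀ Y, imagPow X (-t) * (imagPow X t * Y) = Y :=
      fun X Y => by rw [← Matrix.mul_assoc, imagPow_neg_mul, one_mul]
    have icancel' : ∀ X : Matrix n n ℂ, ∀ Y, imagPow X t * (imagPow X (-t) * Y) = Y :=
      fun X Y => by
        have := imagPow_neg_mul X (-t)
        rw [neg_neg] at this
        rw [← Matrix.mul_assoc, this, one_mul]
    set K := imagPow A t * suppPow A (1 / 2) * suppPow C (-1 / 2) * imagPow C (-t) *
      suppPow B (1 / 2) with hK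
    -- `J = K⁻¹`. The remaining unitary `B^(-it)` stands left of `J` and is grouped with `√ρ`, whose
    -- Hilbert–Schmidt norm it preserves.
    set J := suppPow B (-1 / 2) * (imagPow C t * (suppPow C (1 / 2) *
      (suppPow A (-1 / 2) * imagPow A (-t)))) with hJ
    have hJK : J * K = 1 := by
      have := cancel B hB 1
      rw [mul_one] at this
      simp only [hJ, hK, Matrix.mul_assoc, icancel, cancel A hA, cancel' C hC, icancel', this]
    have hinv : (K * Kᴴ)⁻¹ = Jᴴ * J := by
      rw [Matrix.mul_inv_rev, ← Matrix.conjTranspose_nonsing_inv, Matrix.inv_eq_left_inv hJK]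
    have e4 : suppPow ρ (1 / 2) * (imagPow B (-t) * suppPow B (-1 / 2) *
        (imagPow C t * suppPow C (1 / 2)) * (suppPow A (-1 / 2) * imagPow A (-t)) *
        NormedSpace.exp (z • ((1 / 2 : ℝ) : ℂ) • onSupport Real.log ρ)) *
        suppPow ρ (1 / 2) = (suppPow ρ (1 / 2) * imagPow B (-t)) * (J * ρ * imagPow ρ t) := by
      rw [hJ]
      simp only [Matrix.mul_assoc, e3]
    have e5 : (suppPow ρ (1 / 2) * imagPow B (-t)) * (suppPow ρ (1 / 2) * imagPow B (-t))ᴴ = ρ := by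
      have := Matrix.mem_unitaryGroup_iff.1 (imagPow_mem_unitaryGroup B (-t))
      rw [Matrix.star_eq_conjTranspose] at this
      rw [Matrix.conjTranspose_mul, hS.eq, Matrix.mul_assoc, ← Matrix.mul_assoc (imagPow _ _), this,
        one_mul, hSS]
    have e6 : ((J * ρ * imagPow ρ t)ᴴ * (J * ρ * imagPow ρ t)).trace =
        (ρ * ρ * (K * Kᴴ)⁻¹).trace := by
      have := Matrix.mem_unitaryGroup_iff.1 (imagPow_mem_unitaryGroup ρ t)
      rw [Matrix.star_eq_conjTranspose] at this
      rw [hinv, Matrix.trace_mul_comm]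
      simp only [Matrix.conjTranspose_mul, hρ.1.isHermitian.eq, Matrix.mul_assoc]
      rw [← Matrix.mul_assoc (imagPow _ _), this, one_mul, Matrix.trace_mul_comm]
      simp only [Matrix.mul_assoc]
    rw [e4]
    -- Cauchy–Schwarz: the two squared norms are `Tr ρ = 1` and `Tr {ρ² (K Kᴴ)⁻¹}`.
    refine (norm_trace_mul_le _ _).trans ?_
    rw [e5, e6, hρ.2, Complex.one_re, Real.sqrt_one, one_mul]
    exact Real.sqrt_le_sqrt (h t)

/-! ### Divergences and extremal values -/

theorem elog_mono : Monotone elog := fun _ _ h =>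
  ENNReal.log_monotone (ENNReal.ofReal_le_ofReal h)

theorem elog_of_pos {x : ℝ} (hx : 0 < x) : elog x = (Real.log x : EReal) :=
  ENNReal.log_ofReal_of_pos hx

/-- Transfers an attained real maximum to the extended-real divergences; with `T` an order dual it
also yields minima. -/
theorem isGreatest_recoveryValues_of_monotone {T : Type*} [Preorder T] {F : ℝ → T}
    (hF : Monotone F) {ρ : Matrix (a × b × c) (a × b × c) ℂ}
    {f : Matrix (a × b × c) (a × b × c) ℂ → T} {g : Matrix (a × b × c) (a × b × c) ℂ → ℝ}
    (hfg : ∀ V ∈ swivels (margAC ρ), ∀ W ∈ swivels (margC ρ),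
      f (recovered ρ V W) = F (g (recovered ρ V W)))
    {x : ℝ} (h : IsGreatest (recoveryValues ρ g) x) :
    IsGreatest (recoveryValues ρ f) (F x) := by
  obtain ⟨⟨V, hV, W, hW, rfl⟩, hub⟩ := h
  refine ⟨⟨V, hV, W, hW, (hfg V hV W hW).symm⟩, ?_⟩
  rintro _ ⟨V', hV', W', hW', rfl⟩
  rw [hfg V' hV' W' hW']
  exact hF (hub ⟨V', hV', W', hW', rfl⟩)

theorem continuousOn_fidelity (ρ : Matrix n n ℂ) :
    ContinuousOn (fidelity ρ) {σ | σ.PosSemidef} := by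
  have h0 : ContinuousOn (CFC.sqrt : Matrix n n ℂ → Matrix n n ℂ) {σ | 0 ≤ σ} :=
    CFC.continuousOn_sqrt
  have h1 : ContinuousOn (fun σ => suppPow ρ (1 / 2) * CFC.sqrt σ) {σ : Matrix n n ℂ | 0 ≤ σ} :=
    continuousOn_const.mul h0
  have hstar : Continuous fun X : Matrix n n ℂ => Xᴴ := continuous_id.matrix_conjTranspose
  have h2 : ContinuousOn (fun σ => CFC.sqrt ((suppPow ρ (1 / 2) * CFC.sqrt σ)ᴴ *
      (suppPow ρ (1 / 2) * CFC.sqrt σ))) {σ : Matrix n n ℂ | 0 ≤ σ} :=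
    h0.comp ((hstar.comp_continuousOn h1).mul h1) fun σ _ =>
      Matrix.nonneg_iff_posSemidef.2 (Matrix.posSemidef_conjTranspose_mul_self _)
  have htr : Continuous fun X : Matrix n n ℂ => X.trace.re ^ 2 :=
    (Complex.continuous_re.comp continuous_id.matrix_trace).pow 2
  have h3 : Set.EqOn (fidelity ρ) (fun σ => (CFC.sqrt ((suppPow ρ (1 / 2) * CFC.sqrt σ)ᴴ *
      (suppPow ρ (1 / 2) * CFC.sqrt σ))).trace.re ^ 2) {σ : Matrix n n ℂ | σ.PosSemidef} :=
    fun σ hσ => by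
      simp only [fidelity, traceNorm]
      rw [suppPow_half_eq_sqrt (Matrix.posSemidef_conjTranspose_mul_self _),
        suppPow_half_eq_sqrt hσ]
  refine ContinuousOn.congr ?_ h3
  simp only [← Matrix.nonneg_iff_posSemidef]
  exact htr.comp_continuousOn h2

theorem continuousOn_inv_posDef :
    ContinuousOn (fun σ : Matrix n n ℂ => σ⁻¹) {σ | σ.PosDef} := by
  intro σ hσ
  obtain ⟨u, hu⟩ := hσ.isUnit
  simp only [Matrix.nonsing_inv_eq_ringInverse]
  rw [← hu]
  exact (NormedRing.inverse_continuousAt u).continuousWithinAt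

theorem renyiRelEntropy_zero (ρ : Matrix n n ℂ) {σ : Matrix n n ℂ} (hσ : σ.IsHermitian) :
    renyiRelEntropy 0 ρ σ = -elog (suppPow ρ 0 * σ).trace.re := by
  rw [renyiRelEntropy, if_neg (by norm_num), sub_zero, suppPow_one hσ]
  norm_num

theorem suppLE_of_posDef (ρ : Matrix n n ℂ) {σ : Matrix n n ℂ} (hσ : σ.PosDef) : SuppLE ρ σ := by
  have h : LinearMap.range σ.mulVecLin = ⊤ := by
    rw [LinearMap.range_eq_top]
    exact Matrix.mulVec_surjective_iff_isUnit.2 hσ.isUnit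
  rw [SuppLE, h]
  exact le_top

theorem suppPow_two {A : Matrix n n ℂ} (hA : A.PosSemidef) : suppPow A 2 = A * A := by
  have := suppPow_mul hA 1 1
  rw [suppPow_one hA.isHermitian] at this
  rw [this]
  norm_num

theorem renyiRelEntropy_two {ρ σ : Matrix n n ℂ} (hρ : ρ.PosSemidef) (hσ : σ.PosDef) :
    renyiRelEntropy 2 ρ σ = elog (ρ * ρ * σ⁻¹).trace.re := by
  rw [renyiRelEntropy, if_neg fun h => h.2 (suppLE_of_posDef ρ hσ), suppPow_two hρ,
    show (1 - 2 : ℝ) = -1 by norm_num, suppPow_neg_one_of_posDef hσ]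
  norm_num

/-- This is `‖Xᴴ X‖ = ‖X Xᴴ‖` for `X = √ρ σ^(-1/2)`. The new form involves `σ` only through `σ⁻¹`,
which gives continuity and the comparison with `D_2`. -/
theorem maxRelEntropy_eq {ρ σ : Matrix n n ℂ} (hρ : ρ.PosSemidef) (hσ : σ.PosDef) :
    maxRelEntropy ρ σ = elog ‖suppPow ρ (1 / 2) * σ⁻¹ * suppPow ρ (1 / 2)‖ := by
  rw [maxRelEntropy, if_pos (suppLE_of_posDef ρ hσ), ← Matrix.cstar_norm_def]
  have h1 := Matrix.l2_opNorm_conjTranspose_mul_self (suppPow ρ (1 / 2) * suppPow σ (-1 / 2))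
  have h2 := Matrix.l2_opNorm_conjTranspose_mul_self (suppPow ρ (1 / 2) * suppPow σ (-1 / 2))ᴴ
  rw [Matrix.l2_opNorm_conjTranspose, ← h1] at h2
  simp only [Matrix.conjTranspose_mul, (suppPow_isHermitian _ _).eq] at h2
  have e1 : suppPow σ (-1 / 2) * suppPow ρ (1 / 2) * (suppPow ρ (1 / 2) * suppPow σ (-1 / 2)) =
      suppPow σ (-1 / 2) * ρ * suppPow σ (-1 / 2) := by
    rw [Matrix.mul_assoc, ← Matrix.mul_assoc (suppPow ρ _), suppPow_half_mul_self hρ,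
      Matrix.mul_assoc]
  have e2 : suppPow ρ (1 / 2) * suppPow σ (-1 / 2) * (suppPow σ (-1 / 2) * suppPow ρ (1 / 2)) =
      suppPow ρ (1 / 2) * σ⁻¹ * suppPow ρ (1 / 2) := by
    rw [Matrix.mul_assoc, ← Matrix.mul_assoc (suppPow σ _), suppPow_mul hσ.posSemidef,
      show (-1 / 2 + -1 / 2 : ℝ) = -1 by norm_num, suppPow_neg_one_of_posDef hσ, Matrix.mul_assoc]
  rw [← e1, ← e2, h2]

/-- The left side is `Tr {(√ρ σ⁻¹ √ρ) ρ}` and `Tr ρ = 1`; this is `D_2 ≤ D_max`. -/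
theorem trace_sq_mul_inv_le {ρ : Matrix n n ℂ} (hρ : IsDensity ρ) (σ : Matrix n n ℂ) :
    (ρ * ρ * σ⁻¹).trace.re ≤ ‖suppPow ρ (1 / 2) * σ⁻¹ * suppPow ρ (1 / 2)‖ := by
  have h1 := norm_trace_mul_le_of_posSemidef (suppPow ρ (1 / 2) * σ⁻¹ * suppPow ρ (1 / 2)) hρ.1
  rw [hρ.2, Complex.one_re, mul_one] at h1
  have h2 : (suppPow ρ (1 / 2) * σ⁻¹ * suppPow ρ (1 / 2) * ρ).trace = (ρ * ρ * σ⁻¹).trace := by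
    have hc : suppPow ρ (1 / 2) * ρ = ρ * suppPow ρ (1 / 2) :=
      (onSupport_commute_self _ hρ.1.isHermitian).eq
    rw [Matrix.mul_assoc, hc, ← Matrix.mul_assoc, Matrix.trace_mul_comm]
    simp only [← Matrix.mul_assoc]
    rw [suppPow_half_mul_self hρ.1, Matrix.trace_mul_cycle]
  rw [← h2]
  exact (Complex.re_le_norm _).trans h1

/-! ### The recovered states -/

theorem logTrace_eq_neg_condMutualInfo {ρ : Matrix (a × b × c) (a × b × c) ℂ}
    (hρ : ρ.PosSemidef) :
    logTrace ρ (embedAC a b c (margAC ρ)) (embedBC a b c (margBC ρ)) (embedC a b c (margC ρ)) =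
      -condMutualInfo ρ := by
  rw [logTrace, trace_mul_log_map _ (margAC_posSemidef hρ) (trace_embedAC_mul ρ),
    trace_mul_log_map _ (margBC_posSemidef hρ) (trace_embedBC_mul ρ),
    trace_mul_log_map _ (margC_posSemidef hρ) (trace_embedC_mul ρ), condMutualInfo]
  have : entropy ρ = -(ρ * onSupport Real.log ρ).trace.re := rfl
  linarith

theorem recoveryFactor_imagPow {ρ : Matrix (a × b × c) (a × b × c) ℂ} (hρ : ρ.PosSemidef)
    (t s : ℝ) : recoveryFactor ρ (imagPow (margAC ρ) t) (imagPow (margC ρ) s) =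
      imagPow (embedAC a b c (margAC ρ)) t * suppPow (embedAC a b c (margAC ρ)) (1 / 2) *
      suppPow (embedC a b c (margC ρ)) (-1 / 2) * imagPow (embedC a b c (margC ρ)) s *
      suppPow (embedBC a b c (margBC ρ)) (1 / 2) := by
  rw [recoveryFactor, map_imagPow _ (margAC_posSemidef hρ).isHermitian,
    map_imagPow _ (margC_posSemidef hρ).isHermitian]

theorem recovered_posSemidef {ρ : Matrix (a × b × c) (a × b × c) ℂ} (hρ : ρ.PosSemidef)
    (V : Matrix (a × c) (a × c) ℂ) (W : Matrix c c ℂ) : (recovered ρ V W).PosSemidef := by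
  rw [recovered_eq hρ]
  exact Matrix.posSemidef_self_mul_conjTranspose _

theorem isUnit_suppPow {A : Matrix n n ℂ} (hA : A.PosDef) (r : ℝ) : IsUnit (suppPow A r) :=
  IsUnit.of_mul_eq_one (suppPow A (-r)) (by
    rw [suppPow_mul hA.posSemidef, add_neg_cancel, suppPow_zero_of_posDef hA])

/-- The support projection of `φ σ` fixes the invertible `√ρ`, so it is the identity. -/
theorem map_posDef_of_trace_eq (φ : Matrix m m ℂ →⋆ₐ[ℂ] Matrix n n ℂ) {σ : Matrix m m ℂ}
    {ρ : Matrix n n ℂ} (hσ : σ.PosSemidef) (hρ : ρ.PosDef)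
    (h : ∀ X, (φ X * ρ).trace = (X * σ).trace) : (φ σ).PosDef := by
  have hφ := map_posSemidef φ hσ
  have h1 := suppPow_zero_map_mul φ hσ hρ.posSemidef h
  have h2 : suppPow (φ σ) 0 = 1 :=
    (isUnit_suppPow hρ (1 / 2)).mul_right_cancel (by rw [h1, one_mul])
  rw [hφ.posDef_iff_isUnit]
  refine IsUnit.of_mul_eq_one (suppPow (φ σ) (-1)) ?_
  have h3 := suppPow_mul hφ 1 (-1)
  rwa [suppPow_one hφ.isHermitian, add_neg_cancel, h2] at h3

theorem recovered_posDef {ρ : Matrix (a × b × c) (a × b × c) ℂ} (hρ : ρ.PosDef)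
    {V : Matrix (a × c) (a × c) ℂ} (hV : V ∈ swivels (margAC ρ)) {W : Matrix c c ℂ}
    (hW : W ∈ swivels (margC ρ)) : (recovered ρ V W).PosDef := by
  rw [(recovered_posSemidef hρ.posSemidef V W).posDef_iff_isUnit, recovered_eq hρ.posSemidef]
  have hu : ∀ {U : Matrix (a × b × c) (a × b × c) ℂ}, U ∈ Matrix.unitaryGroup _ ℂ → IsUnit U :=
    fun hU => IsUnit.of_mul_eq_one _ (Matrix.mem_unitaryGroup_iff.1 hU)
  have hs := hρ.posSemidef
  have hK : IsUnit (recoveryFactor ρ V W) :=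
    ((((hu (map_mem_unitaryGroup _ hV.1)).mul (isUnit_suppPow
      (map_posDef_of_trace_eq _ (margAC_posSemidef hs) hρ (trace_embedAC_mul ρ)) _)).mul
      (isUnit_suppPow
      (map_posDef_of_trace_eq _ (margC_posSemidef hs) hρ (trace_embedC_mul ρ)) _)).mul
      (hu (map_mem_unitaryGroup _ hW.1))).mul (isUnit_suppPow
      (map_posDef_of_trace_eq _ (margBC_posSemidef hs) hρ (trace_embedBC_mul ρ)) _)
  exact hK.mul hK.star

/-- If `r ≤ log M` for all positive `M ≥ x`, then `x` is positive and `r ≤ log x`. -/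
theorem pos_and_le_log {x r : ℝ} (h : ∀ M, 0 < M → x ≤ M → r ≤ Real.log M) :
    0 < x ∧ r ≤ Real.log x := by
  have hx : 0 < x := by
    by_contra! hx
    -- If `x ≤ 0`, every positive `M` is admissible, and `M = e^(r-1)` would give `r ≤ r - 1`.
    have := h (Real.exp (r - 1)) (Real.exp_pos _) (hx.trans (Real.exp_pos _).le)
    rw [Real.log_exp] at this
    linarith
  exact ⟨hx, h x hx le_rfl⟩

theorem neg_condMutualInfo_le_log_of_isGreatest {ρ : Matrix (a × b × c) (a × b × c) ℂ}
    (hρ : IsDensity ρ) {x : ℝ} (hx : IsGreatest (recoveryValues ρ (fidelity ρ)) x) :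
    0 < x ∧ -condMutualInfo ρ ≤ Real.log x := by
  have hA := margAC_posSemidef hρ.1
  have hB := margBC_posSemidef hρ.1
  have hC := margC_posSemidef hρ.1
  refine pos_and_le_log fun M hM hxM => ?_
  rw [← logTrace_eq_neg_condMutualInfo hρ.1]
  refine logTrace_le_log_of_fidelity_le hρ (map_posSemidef _ hA) (map_posSemidef _ hB)
    (map_posSemidef _ hC) (suppPow_zero_map_mul _ hA hρ.1 (trace_embedAC_mul ρ))
    (suppPow_zero_map_mul _ hB hρ.1 (trace_embedBC_mul ρ))
    (suppPow_zero_map_mul _ hC hρ.1 (trace_embedC_mul ρ)) hM fun t => ?_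
  rw [← recoveryFactor_imagPow hρ.1, ← recovered_eq hρ.1]
  exact (hx.2 ⟨_, imagPow_mem_swivels hA.isHermitian t, _,
    imagPow_mem_swivels hC.isHermitian (-t), rfl⟩).trans hxM

theorem condMutualInfo_le_log_of_isGreatest {ρ : Matrix (a × b × c) (a × b × c) ℂ}
    (hρ : IsDensity ρ) (hpos : ρ.PosDef) {x : ℝ}
    (hx : IsGreatest (recoveryValues ρ fun σ => (ρ * ρ * σ⁻¹).trace.re) x) :
    0 < x ∧ condMutualInfo ρ ≤ Real.log x := by
  have hA := margAC_posSemidef hρ.1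
  have hB := margBC_posSemidef hρ.1
  have hC := margC_posSemidef hρ.1
  refine pos_and_le_log fun M hM hxM => ?_
  rw [← neg_neg (condMutualInfo ρ), ← logTrace_eq_neg_condMutualInfo hρ.1]
  refine neg_logTrace_le_log_of_trace_le hρ
    (map_posDef_of_trace_eq _ hA hpos (trace_embedAC_mul ρ))
    (map_posDef_of_trace_eq _ hB hpos (trace_embedBC_mul ρ))
    (map_posDef_of_trace_eq _ hC hpos (trace_embedC_mul ρ)) hM fun t => ?_
  rw [← recoveryFactor_imagPow hρ.1, ← recovered_eq hρ.1]
  exact (hx.2 ⟨_, imagPow_mem_swivels hA.isHermitian t, _,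
    imagPow_mem_swivels hC.isHermitian (-t), rfl⟩).trans hxM

theorem exists_isGreatest_fidelity {ρ : Matrix (a × b × c) (a × b × c) ℂ} (hρ : IsDensity ρ) :
    ∃ x : ℝ, IsGreatest (recoveryValues ρ (fidelity ρ)) x ∧
      -elog x ≤ (condMutualInfo ρ : EReal) := by
  obtain ⟨x, hx⟩ := exists_isGreatest_recoveryValues hρ.1 (continuousOn_fidelity ρ)
    fun V _ W _ => recovered_posSemidef hρ.1 V W
  obtain ⟨hx0, hle⟩ := neg_condMutualInfo_le_log_of_isGreatest hρ hx
  refine ⟨x, hx, ?_⟩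
  rw [elog_of_pos hx0, ← EReal.coe_neg, EReal.coe_le_coe_iff]
  linarith

theorem exists_isLeast_renyiRelEntropy_zero {ρ : Matrix (a × b × c) (a × b × c) ℂ}
    (hρ : IsDensity ρ) :
    ∃ d : EReal, IsLeast (recoveryValues ρ (renyiRelEntropy 0 ρ)) d ∧
      d ≤ (condMutualInfo ρ : EReal) := by
  have hcont : Continuous fun σ : Matrix (a × b × c) (a × b × c) ℂ =>
      (suppPow ρ 0 * σ).trace.re :=
    Complex.continuous_re.comp (continuous_const.mul continuous_id).matrix_trace
  obtain ⟨y, hy⟩ := exists_isGreatest_recoveryValues hρ.1 (hcont.continuousOn (s := Set.univ))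
    fun _ _ _ _ => Set.mem_univ _
  obtain ⟨x, ⟨⟨V, hV, W, hW, rfl⟩, -⟩, hle⟩ := exists_isGreatest_fidelity hρ
  -- In the order dual, the minimum of `D_0` becomes the image of the maximum of `Tr {ρ^0 σ}` under
  -- a monotone map.
  have hmono : Monotone fun x => OrderDual.toDual (-elog x) := fun _ _ h =>
    EReal.neg_le_neg_iff.2 (elog_mono h)
  refine ⟨-elog y, isGreatest_recoveryValues_of_monotone hmono
    (f := fun σ => OrderDual.toDual (renyiRelEntropy 0 ρ σ))
    (fun V _ W _ => congrArg OrderDual.toDual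
      (renyiRelEntropy_zero ρ (recovered_posSemidef hρ.1 V W).isHermitian)) hy, ?_⟩
  refine le_trans (EReal.neg_le_neg_iff.2 (elog_mono ?_)) hle
  -- The pair maximizing the fidelity is a competitor in the maximum `y`.
  exact (fidelity_le_trace hρ (recovered_posSemidef hρ.1 V W)).trans (hy.2 ⟨V, hV, W, hW, rfl⟩)

theorem exists_isGreatest_trace_sq_mul_inv {ρ : Matrix (a × b × c) (a × b × c) ℂ}
    (hρ : ρ.PosDef) :
    ∃ x : ℝ, IsGreatest (recoveryValues ρ fun σ => (ρ * ρ * σ⁻¹).trace.re) x := by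
  refine exists_isGreatest_recoveryValues hρ.posSemidef (s := {σ | σ.PosDef}) ?_
    fun V hV W hW => recovered_posDef hρ hV hW
  have h : Continuous fun X : Matrix (a × b × c) (a × b × c) ℂ => (ρ * ρ * X).trace.re :=
    Complex.continuous_re.comp (continuous_const.mul continuous_id).matrix_trace
  exact h.comp_continuousOn continuousOn_inv_posDef

theorem exists_isGreatest_renyiRelEntropy_two {ρ : Matrix (a × b × c) (a × b × c) ℂ}
    (hρ : IsDensity ρ) (hpos : ρ.PosDef) :
    ∃ d : EReal, IsGreatest (recoveryValues ρ (renyiRelEntropy 2 ρ)) d ∧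
      (condMutualInfo ρ : EReal) ≤ d := by
  obtain ⟨x, hx⟩ := exists_isGreatest_trace_sq_mul_inv hpos
  obtain ⟨hx0, hle⟩ := condMutualInfo_le_log_of_isGreatest hρ hpos hx
  refine ⟨elog x, isGreatest_recoveryValues_of_monotone elog_mono
    (fun V hV W hW => renyiRelEntropy_two hρ.1 (recovered_posDef hpos hV hW)) hx, ?_⟩
  rw [elog_of_pos hx0]
  exact EReal.coe_le_coe_iff.2 hle

theorem exists_isGreatest_maxRelEntropy {ρ : Matrix (a × b × c) (a × b × c) ℂ}
    (hρ : IsDensity ρ) (hpos : ρ.PosDef) :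
    ∃ d : EReal, IsGreatest (recoveryValues ρ (maxRelEntropy ρ)) d ∧
      (condMutualInfo ρ : EReal) ≤ d := by
  have hcont : ContinuousOn (fun σ : Matrix (a × b × c) (a × b × c) ℂ =>
      ‖suppPow ρ (1 / 2) * σ⁻¹ * suppPow ρ (1 / 2)‖) {σ | σ.PosDef} :=
    ((continuousOn_const.mul continuousOn_inv_posDef).mul continuousOn_const).norm
  obtain ⟨y, hy⟩ := exists_isGreatest_recoveryValues hρ.1 hcont
    fun V hV W hW => recovered_posDef hpos hV hW
  obtain ⟨x, hx⟩ := exists_isGreatest_trace_sq_mul_inv hpos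
  obtain ⟨hx0, hle⟩ := condMutualInfo_le_log_of_isGreatest hρ hpos hx
  refine ⟨elog y, isGreatest_recoveryValues_of_monotone elog_mono
    (g := fun σ => ‖suppPow ρ (1 / 2) * σ⁻¹ * suppPow ρ (1 / 2)‖)
    (fun V hV W hW => maxRelEntropy_eq hρ.1 (recovered_posDef hpos hV hW)) hy, ?_⟩
  refine le_trans ?_ (elog_mono (?_ : x ≤ y))
  · rw [elog_of_pos hx0]
    exact EReal.coe_le_coe_iff.2 hle
  -- The pair maximizing `Tr {ρ² σ⁻¹}` is a competitor in the maximum `y`.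
  · obtain ⟨V, hV, W, hW, rfl⟩ := hx.1
    exact (trace_sq_mul_inv_le hρ _).trans (hy.2 ⟨V, hV, W, hW, rfl⟩)

end SwiveledRenyi

theorem mainTheorem6 {a b c : Type*} [Fintype a] [DecidableEq a] [Fintype b] [DecidableEq b]
    [Fintype c] [DecidableEq c] (ρ : Matrix (a × b × c) (a × b × c) ℂ) (hρ : IsDensity ρ) :
    (∃ m : ℝ, IsGreatest (recoveryValues ρ (fidelity ρ)) m ∧
      - elog m ≤ (condMutualInfo ρ : EReal)) ∧
    (∃ d : EReal, IsLeast (recoveryValues ρ (renyiRelEntropy 0 ρ)) d ∧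
      d ≤ (condMutualInfo ρ : EReal)) ∧
    (ρ.PosDef →
      (∃ d : EReal, IsGreatest (recoveryValues ρ (maxRelEntropy ρ)) d ∧
        (condMutualInfo ρ : EReal) ≤ d) ∧
      (∃ d : EReal, IsGreatest (recoveryValues ρ (renyiRelEntropy 2 ρ)) d ∧
        (condMutualInfo ρ : EReal) ≤ d)) := by
  exact ⟨exists_isGreatest_fidelity hρ, exists_isLeast_renyiRelEntropy_zero hρ, fun hpos =>
    ⟨exists_isGreatest_maxRelEntropy hρ hpos, exists_isGreatest_renyiRelEntropy_two hρ hpos⟩⟩
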